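/- Let $k\ge 1$ be an integer, $\rho>0$, and let $B^{k+1}_\rho=\{m\in\mathbb R^{k+1}:|m|<\rho\}$ be the ball model of the hyperbolic space of constant sectional curvature $-1/\rho^2$, with metric $2\rho^2|ds|/(\rho^2-|m|^2)$, hyperbolic distance $d$ and Laplace--Beltrami operator $\triangle$. Fix $u\in\mathbb R^{k+1}$ with $|u|=\rho$ and $\alpha\in\mathbb C$, put $$\omega(u,m)=\frac{|u|^2-|m|^2}{|u-m|^2},\qquad V_\alpha(\eta)=\frac{1}{|S(\eta)|}\int_{S(\eta)}\omega^\alpha(u,m)\,dS_m\quad(0<\eta<\rho),\qquad V_\alpha(0)=\omega^\alpha(u,0),$$ where $S(\eta)$ is the Euclidean sphere of radius $\eta$ centered at the origin $O$ and $dS$ is its Euclidean surface measure, and let $$\mu=\frac{\alpha k-\alpha^2}{\rho^2},\qquad \varphi_\mu(r)=V_\alpha\!\left(\rho\tanh\frac{r}{2\rho}\right)\quad(r\ge 0).$$ Then: 1. for every $m\in B^{k+1}_\rho$, the hyperbolic distance $r=d(O,m)$ satisfies $|m|=\rho\tanh(r/(2\rho))$, so that $\varphi_\mu(r)=V_\alpha(|m|)$;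 2. $\varphi_\mu$ is a radial eigenfunction with eigenvalue $\mu$ and value $1$ at the origin: the function $m\mapsto\varphi_\mu(d(O,m))$ is of class $C^2$ on $B^{k+1}_\rho$ and satisfies there $\triangle\varphi_\mu+\mu\varphi_\mu=0$, and $\varphi_\mu(0)=1$; 3. it is the only one: if $\psi:[0,\infty)\to\mathbb C$ is such that $m\mapsto\psi(d(O,m))$ is of class $C^2$ on $B^{k+1}_\rho$ and satisfies $\triangle\psi+\mu\psi=0$ there, and $\psi(0)=1$, then $\psi(r)=\varphi_\mu(r)$ for all $r\ge0$. The same holds if $m\mapsto\psi(d(O,m))$ is only required to be of class $C^2$ and to satisfy the equation on $B^{k+1}_\rho\setminus\{O\}$, provided that $\psi$ is continuous at $0$ with $\psi(0)=1$. -/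

import Mathlib

open MeasureTheory Set Metric

namespace HypBall

noncomputable section

/-- The `i`-th partial derivative of a complex-valued function on `ℝⁿ`. -/
def partialDeriv {n : ℕ} (i : Fin n) (f : EuclideanSpace ℝ (Fin n) → ℂ)
    (x : EuclideanSpace ℝ (Fin n)) : ℂ :=
  fderiv ℝ f x (EuclideanSpace.single i 1)

/-- The Laplace–Beltrami operator of a Riemannian metric `g = (g_{ij})` given on an open subset
of `ℝⁿ`: `Δ f = |g|^{-1/2} ∑ᵢ ∂ᵢ (|g|^{1/2} ∑ⱼ g^{ij} ∂ⱼ f)`. -/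
def laplaceBeltrami {n : ℕ} (g : EuclideanSpace ℝ (Fin n) → Matrix (Fin n) (Fin n) ℝ)
    (f : EuclideanSpace ℝ (Fin n) → ℂ) (x : EuclideanSpace ℝ (Fin n)) : ℂ :=
  (√(g x).det)⁻¹ •
    ∑ i, partialDeriv i (fun y => √(g y).det • ∑ j, (g y)⁻¹ i j • partialDeriv j f y) x

/-- The length of a path `γ : [0, 1] → ℝⁿ` with respect to a Riemannian metric `g`. -/
def pathLength {n : ℕ} (g : EuclideanSpace ℝ (Fin n) → Matrix (Fin n) (Fin n) ℝ)
    (γ : ℝ → EuclideanSpace ℝ (Fin n)) : ℝ :=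
  ∫ t in (0 : ℝ)..1,
    √((derivWithin γ (Icc 0 1) t).ofLp ⬝ᵥ ((g (γ t)).mulVec (derivWithin γ (Icc 0 1) t).ofLp))

/-- The Riemannian distance of `x` and `y` in a domain `Ω` with the metric `g`: the infimum of the
lengths of the `C¹` paths in `Ω` from `x` to `y`. -/
def riemDist {n : ℕ} (Ω : Set (EuclideanSpace ℝ (Fin n)))
    (g : EuclideanSpace ℝ (Fin n) → Matrix (Fin n) (Fin n) ℝ)
    (x y : EuclideanSpace ℝ (Fin n)) : ℝ :=
  sInf {L | ∃ γ : ℝ → EuclideanSpace ℝ (Fin n), ContDiffOn ℝ 1 γ (Icc 0 1) ∧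
    MapsTo γ (Icc 0 1) Ω ∧ γ 0 = x ∧ γ 1 = y ∧ L = pathLength g γ}

/-- The metric `2 ρ² |ds| / (ρ² - |x|²)` of the ball model (the ball `|x| < ρ`) of the hyperbolic
space of constant sectional curvature `-1/ρ²`. -/
def ballMetric {n : ℕ} (ρ : ℝ) (x : EuclideanSpace ℝ (Fin n)) : Matrix (Fin n) (Fin n) ℝ :=
  (2 * ρ ^ 2 / (ρ ^ 2 - ‖x‖ ^ 2)) ^ 2 • (1 : Matrix (Fin n) (Fin n) ℝ)

/-- The hyperbolic Laplacian in the ball model. -/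
def hypLaplacian {n : ℕ} (ρ : ℝ) (f : EuclideanSpace ℝ (Fin n) → ℂ)
    (x : EuclideanSpace ℝ (Fin n)) : ℂ :=
  laplaceBeltrami (ballMetric ρ) f x

/-- The hyperbolic distance in the ball model. -/
def hypDist {n : ℕ} (ρ : ℝ) (x y : EuclideanSpace ℝ (Fin n)) : ℝ :=
  riemDist (ball 0 ρ) (ballMetric ρ) x y

/-- The surface measure of the Euclidean sphere `|x| = η` in `ℝ^{k+1}`, for `η > 0`, as a measure
on `ℝ^{k+1}`: the surface measure of the unit sphere, transported by `θ ↦ η θ` and multiplied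
by `η ^ k`. -/
def sphereMeasure (k : ℕ) (η : ℝ) : Measure (EuclideanSpace ℝ (Fin (k + 1))) :=
  ENNReal.ofReal (η ^ k) •
    Measure.map (fun θ : sphere (0 : EuclideanSpace ℝ (Fin (k + 1))) 1 =>
        η • (θ : EuclideanSpace ℝ (Fin (k + 1))))
      (volume : Measure (EuclideanSpace ℝ (Fin (k + 1)))).toSphere

/-- The mean of `f` over the sphere `|x| = η`; for `η = 0` the sphere is the origin.
The radialization of `f` about the origin is `m ↦ sphericalMean k f ‖m‖`. -/
def sphericalMean (k : ℕ) (f : EuclideanSpace ℝ (Fin (k + 1)) → ℂ) (η : ℝ) : ℂ :=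
  if η = 0 then f 0
  else ((sphereMeasure k η).real univ)⁻¹ • ∫ m, f m ∂(sphereMeasure k η)

/-- `ω(u, m) = (|u|² - |m|²) / |u - m|²`. -/
def omega {n : ℕ} (u m : EuclideanSpace ℝ (Fin n)) : ℝ :=
  (‖u‖ ^ 2 - ‖m‖ ^ 2) / ‖u - m‖ ^ 2

/-- `V_α(η)`: the radialization of `ω^α(u, ·)` on the sphere `|m| = η`. -/
def V (k : ℕ) (u : EuclideanSpace ℝ (Fin (k + 1))) (α : ℂ) (η : ℝ) : ℂ :=
  sphericalMean k (fun m => (omega u m : ℂ) ^ α) η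

/-- The function of the hyperbolic distance `r` from the origin given by `φ`, that is
`m ↦ φ (d(O, m))`, is of class `C²` on the open subset `Ω` of the ball model of dimension `k + 1`
and satisfies `Δ φ + μ φ = 0` there. -/
def IsRadialEigenfunctionOn (k : ℕ) (ρ : ℝ) (μ : ℂ)
    (Ω : Set (EuclideanSpace ℝ (Fin (k + 1)))) (φ : ℝ → ℂ) : Prop :=
  ContDiffOn ℝ 2 (fun m : EuclideanSpace ℝ (Fin (k + 1)) => φ (hypDist ρ 0 m)) Ω ∧
    ∀ m ∈ Ω, hypLaplacian ρ (fun x => φ (hypDist ρ 0 x)) m + μ * φ (hypDist ρ 0 m) = 0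

end

end HypBall

/-!
The function `log ω(v, ·)` has constant hyperbolic gradient length and constant hyperbolic
Laplacian, so its exponential `ω(v, ·) ^ α` is an eigenfunction of the hyperbolic Laplacian. The
kernel `ω` is invariant under simultaneous rotations of its two arguments, so the mean of
`ω(u, ·) ^ α` over the sphere of radius `|m|` equals the mean of `ω(v, m) ^ α` over the boundary
points `v`; as a function of `m` the latter is an eigenfunction, by differentiation under the
integral sign.

For uniqueness, an eigenfunction `ψ(r)` of the hyperbolic distance `r` solves, away from the origin,
a Sturm–Liouville equation with weight `sinh (r / ρ) ^ k`, which is `O(r)` at `0`. If two solutions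
have the same nonzero limit at `0`, their quotient is bounded there, whereas a nonzero Wronskian
would make it diverge logarithmically.
-/

namespace HypBall

open Filter Topology Module
open scoped Gradient InnerProductSpace Laplacian Pointwise

section ChainRule

variable {E F : Type*} [NormedAddCommGroup E] [InnerProductSpace ℝ E]
  [NormedAddCommGroup F] [NormedSpace ℝ F]

theorem hasFDerivAt_comp_real {f : E → ℝ} {φ : ℝ → F} {x : E} (hf : DifferentiableAt ℝ f x)
    (hφ : DifferentiableAt ℝ φ (f x)) :
    HasFDerivAt (fun y => φ (f y)) ((fderiv ℝ f x).smulRight (deriv φ (f x))) x := by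
  refine (hφ.hasDerivAt.hasFDerivAt.comp x hf.hasFDerivAt).congr_fderiv ?_
  ext v
  simp

theorem fderiv_fderiv_comp_real {f : E → ℝ} {φ : ℝ → F} {x : E} (hf : ContDiffAt ℝ 2 f x)
    (hφ : ContDiffAt ℝ 2 φ (f x)) (v : E) :
    fderiv ℝ (fderiv ℝ fun y => φ (f y)) x v v =
      fderiv ℝ (fderiv ℝ f) x v v • deriv φ (f x) +
        fderiv ℝ f x v ^ 2 • deriv (deriv φ) (f x) := by
  have hfderiv : fderiv ℝ (fun y => φ (f y)) =ᶠ[𝓝 x]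
      fun y => ContinuousLinearMap.smulRightL ℝ E F (fderiv ℝ f y) (deriv φ (f y)) := by
    filter_upwards [hf.eventually (by simp), hf.continuousAt.eventually (hφ.eventually (by simp))]
      with y hfy hφy
    exact (hasFDerivAt_comp_real (hfy.differentiableAt two_ne_zero)
      (hφy.differentiableAt two_ne_zero)).fderiv
  have hf' : DifferentiableAt ℝ (fderiv ℝ f) x :=
    (hf.fderiv_right (m := 1) le_rfl).differentiableAt one_ne_zero
  have hφ' : DifferentiableAt ℝ (deriv φ) (f x) :=
    (hφ.derivWithin (m := 1) le_rfl).differentiableAt one_ne_zero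
  have hcomp := hasFDerivAt_comp_real (hf.differentiableAt two_ne_zero) hφ'
  rw [hfderiv.fderiv_eq,
    (((ContinuousLinearMap.smulRightL ℝ E F).hasFDerivAt.comp x hf'.hasFDerivAt).clm_apply
      hcomp).fderiv]
  simp [smul_smul, pow_two, add_comm]

theorem fderiv_norm_sub_sq (v x : E) :
    fderiv ℝ (fun y => ‖y - v‖ ^ 2) x = 2 • innerSL ℝ (x - v) := by
  rw [fderiv_comp_sub (f := fun y : E => ‖y‖ ^ 2), fderiv_norm_sq_apply]

section Complete

variable [CompleteSpace E]

theorem gradient_comp_real {f : E → ℝ} {φ : ℝ → ℝ} {x : E} (hf : DifferentiableAt ℝ f x)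
    (hφ : DifferentiableAt ℝ φ (f x)) :
    ∇ (fun y => φ (f y)) x = deriv φ (f x) • ∇ f x := by
  refine ext_inner_right ℝ fun v => ?_
  rw [inner_gradient_left, (hasFDerivAt_comp_real hf hφ).fderiv, inner_smul_left,
    inner_gradient_left]
  simp [mul_comm]

theorem gradient_norm_sub_sq (v x : E) :
    ∇ (fun y => ‖y - v‖ ^ 2) x = (2 : ℝ) • (x - v) := by
  refine ext_inner_right ℝ fun w => ?_
  rw [inner_gradient_left, fderiv_norm_sub_sq]
  simp [inner_smul_left, inner_sub_left]

end Complete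

variable [FiniteDimensional ℝ E]

theorem laplacian_eq_sum_fderiv_fderiv {ι : Type*} [Fintype ι] (b : OrthonormalBasis ι ℝ E)
    (f : E → F) (x : E) : Δ f x = ∑ i, fderiv ℝ (fderiv ℝ f) x (b i) (b i) := by
  simp [InnerProductSpace.laplacian_eq_iteratedFDeriv_orthonormalBasis f b,
    iteratedFDeriv_two_apply]

theorem laplacian_comp_real {f : E → ℝ} {φ : ℝ → F} {x : E} (hf : ContDiffAt ℝ 2 f x)
    (hφ : ContDiffAt ℝ 2 φ (f x)) :
    Δ (fun y => φ (f y)) x = Δ f x • deriv φ (f x) + ‖∇ f x‖ ^ 2 • deriv (deriv φ) (f x) := by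
  simp only [laplacian_eq_sum_fderiv_fderiv (stdOrthonormalBasis ℝ E),
    fderiv_fderiv_comp_real hf hφ, Finset.sum_add_distrib, ← Finset.sum_smul,
    ← (stdOrthonormalBasis ℝ E).sum_sq_inner_left (∇ f x), inner_gradient_left]

theorem laplacian_norm_sub_sq (v x : E) :
    Δ (fun y => ‖y - v‖ ^ 2) x = 2 * finrank ℝ E := by
  have hsecond (w : E) : fderiv ℝ (fderiv ℝ fun y => ‖y - v‖ ^ 2) x w w = 2 * ‖w‖ ^ 2 := by
    rw [funext (fderiv_norm_sub_sq v)]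
    change fderiv ℝ (fun y => (2 • innerSL ℝ : E →L[ℝ] E →L[ℝ] ℝ) (y - v)) x w w = _
    rw [fderiv_comp_sub, ContinuousLinearMap.fderiv]
    simp [show innerSL ℝ w w = ‖w‖ ^ 2 from real_inner_self_eq_norm_sq w]
  simp [laplacian_eq_sum_fderiv_fderiv (stdOrthonormalBasis ℝ E), hsecond, mul_comm]

end ChainRule

section ConformalFactor

variable {E : Type*} [NormedAddCommGroup E] {ρ : ℝ} {x : E}

/-- The factor by which the hyperbolic metric of the ball of radius `ρ` is conformal to the
Euclidean one. -/
noncomputable def conformalFactor (ρ : ℝ) (x : E) : ℝ := 2 * ρ ^ 2 / (ρ ^ 2 - ‖x‖ ^ 2)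

theorem sq_sub_norm_sq_pos (hx : x ∈ ball 0 ρ) : 0 < ρ ^ 2 - ‖x‖ ^ 2 :=
  sub_pos.2 (pow_lt_pow_left₀ (mem_ball_zero_iff.1 hx) (norm_nonneg x) two_ne_zero)

theorem conformalFactor_pos (hx : x ∈ ball 0 ρ) : 0 < conformalFactor ρ x :=
  div_pos (mul_pos two_pos (pow_pos (pos_of_mem_ball hx) 2)) (sq_sub_norm_sq_pos hx)

variable [InnerProductSpace ℝ E]

theorem contDiffOn_conformalFactor {N : WithTop ℕ∞} :
    ContDiffOn ℝ N (conformalFactor ρ : E → ℝ) (ball 0 ρ) :=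
  contDiffOn_const.div (contDiffOn_const.sub (contDiff_id.norm_sq ℝ).contDiffOn)
    fun _ hx => (sq_sub_norm_sq_pos hx).ne'

theorem hasFDerivAt_conformalFactor (hx : x ∈ ball 0 ρ) :
    HasFDerivAt (conformalFactor ρ) ((conformalFactor ρ x ^ 2 / ρ ^ 2) • innerSL ℝ x) x := by
  have hρ : ρ ≠ 0 := (pos_of_mem_ball hx).ne'
  have hne : ρ ^ 2 - ‖x‖ ^ 2 ≠ 0 := (sq_sub_norm_sq_pos hx).ne'
  refine (((hasDerivAt_inv hne).comp_hasFDerivAt x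
    ((hasStrictFDerivAt_norm_sq x).hasFDerivAt.const_sub _)).const_mul (2 * ρ ^ 2)).congr_fderiv ?_
  ext v
  simp only [smul_neg, neg_smul, neg_neg, smul_apply, coe_innerSL_apply, nsmul_eq_mul,
    Nat.cast_ofNat, smul_eq_mul, conformalFactor]
  field_simp

theorem hasFDerivAt_conformalFactor_zpow (m : ℤ) (hx : x ∈ ball 0 ρ) :
    HasFDerivAt (fun y => conformalFactor ρ y ^ m)
      ((m * conformalFactor ρ x ^ (m + 1) / ρ ^ 2) • innerSL ℝ x) x := by
  have hne := (conformalFactor_pos hx).ne'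
  refine ((hasDerivAt_zpow m _ (.inl hne)).comp_hasFDerivAt x
    (hasFDerivAt_conformalFactor hx)).congr_fderiv ?_
  rw [smul_smul, zpow_add_one₀ hne, zpow_sub_one₀ hne]
  congr 1
  field_simp

end ConformalFactor

section BallGradient

variable {E : Type*} [NormedAddCommGroup E] [InnerProductSpace ℝ E] [CompleteSpace E]
  {ρ : ℝ} {x : E}

/-- The squared length of the gradient of `f` with respect to the hyperbolic metric of the ball of
radius `ρ`; here `∇` is the Euclidean gradient. -/
noncomputable def ballGradientSq (ρ : ℝ) (f : E → ℝ) (x : E) : ℝ :=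
  (conformalFactor ρ x ^ 2)⁻¹ * ‖∇ f x‖ ^ 2

theorem ballGradientSq_comp_real {f : E → ℝ} {φ : ℝ → ℝ} (hf : DifferentiableAt ℝ f x)
    (hφ : DifferentiableAt ℝ φ (f x)) :
    ballGradientSq ρ (fun y => φ (f y)) x = deriv φ (f x) ^ 2 * ballGradientSq ρ f x := by
  rw [ballGradientSq, gradient_comp_real hf hφ, norm_smul, mul_pow, Real.norm_eq_abs, sq_abs,
    ballGradientSq]
  ring

end BallGradient

section BallLaplacian

variable {E F : Type*} [NormedAddCommGroup E] [InnerProductSpace ℝ E] [FiniteDimensional ℝ E]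
  [NormedAddCommGroup F] [NormedSpace ℝ F] {ρ : ℝ} {x : E}

/-- The hyperbolic Laplacian of the ball of radius `ρ` in nondivergence form. Unlike
`hypLaplacian`, it needs no coordinates and makes sense for functions with values in any real
normed space. -/
noncomputable def ballLaplacian (ρ : ℝ) (f : E → F) (x : E) : F :=
  (conformalFactor ρ x ^ 2)⁻¹ •
    (Δ f x + ((finrank ℝ E - 2) * conformalFactor ρ x / ρ ^ 2) • fderiv ℝ f x x)

theorem ballLaplacian_congr {f g : E → F} (h : f =ᶠ[𝓝 x] g) :
    ballLaplacian ρ f x = ballLaplacian ρ g x := by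
  rw [ballLaplacian, ballLaplacian, (InnerProductSpace.laplacian_congr_nhds h).eq_of_nhds,
    h.fderiv_eq]

theorem ballLaplacian_const_smul {f : E → F} (c : ℝ) (hf : ContDiffAt ℝ 2 f x) :
    ballLaplacian ρ (fun y => c • f y) x = c • ballLaplacian ρ f x := by
  have hlap : (Δ fun y => c • f y) x = c • (Δ f) x := InnerProductSpace.laplacian_smul c hf
  rw [ballLaplacian, hlap, fderiv_fun_const_smul (hf.differentiableAt two_ne_zero), smul_apply,
    smul_comm _ c (fderiv ℝ f x x), ← smul_add, smul_comm _ c, ballLaplacian]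

theorem ballLaplacian_comp_real {f : E → ℝ} {φ : ℝ → F} (hf : ContDiffAt ℝ 2 f x)
    (hφ : ContDiffAt ℝ 2 φ (f x)) :
    ballLaplacian ρ (fun y => φ (f y)) x =
      ballGradientSq ρ f x • deriv (deriv φ) (f x) + ballLaplacian ρ f x • deriv φ (f x) := by
  rw [ballLaplacian, laplacian_comp_real hf hφ, (hasFDerivAt_comp_real
    (hf.differentiableAt two_ne_zero) (hφ.differentiableAt two_ne_zero)).fderiv]
  simp only [ballLaplacian, ballGradientSq, ContinuousLinearMap.smulRight_apply, smul_eq_mul]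
  module

end BallLaplacian

section Coordinates

variable {n : ℕ} {ρ : ℝ} {x : EuclideanSpace ℝ (Fin n)}

theorem ballMetric_eq_conformalFactor_sq_smul_one (ρ : ℝ) (x : EuclideanSpace ℝ (Fin n)) :
    ballMetric ρ x = conformalFactor ρ x ^ 2 • (1 : Matrix (Fin n) (Fin n) ℝ) := rfl

theorem sqrt_det_ballMetric (hx : x ∈ ball 0 ρ) :
    √(ballMetric ρ x).det = conformalFactor ρ x ^ n := by
  rw [ballMetric_eq_conformalFactor_sq_smul_one, Matrix.det_smul, Matrix.det_one, mul_one,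
    Fintype.card_fin, pow_right_comm, Real.sqrt_sq (pow_nonneg (conformalFactor_pos hx).le _)]

theorem inv_ballMetric (hx : x ∈ ball 0 ρ) :
    (ballMetric ρ x)⁻¹ = (conformalFactor ρ x ^ 2)⁻¹ • (1 : Matrix (Fin n) (Fin n) ℝ) := by
  refine Matrix.inv_eq_right_inv ?_
  rw [ballMetric_eq_conformalFactor_sq_smul_one, smul_mul_smul_comm, mul_one,
    mul_inv_cancel₀ (pow_pos (conformalFactor_pos hx) 2).ne', one_smul]

theorem partialDeriv_congr {i : Fin n} {f g : EuclideanSpace ℝ (Fin n) → ℂ} (h : f =ᶠ[𝓝 x] g) :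
    partialDeriv i f x = partialDeriv i g x := by
  rw [partialDeriv, partialDeriv, h.fderiv_eq]

theorem hypLaplacian_eq_sum_partialDeriv (hx : x ∈ ball 0 ρ) (f : EuclideanSpace ℝ (Fin n) → ℂ) :
    hypLaplacian ρ f x = (conformalFactor ρ x ^ n)⁻¹ • ∑ i,
      partialDeriv i (fun y => conformalFactor ρ y ^ (n - 2 : ℤ) • partialDeriv i f y) x := by
  rw [hypLaplacian, laplaceBeltrami, sqrt_det_ballMetric hx]
  congr 1
  refine Finset.sum_congr rfl fun i _ => partialDeriv_congr ?_
  filter_upwards [isOpen_ball.mem_nhds hx] with y hy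
  rw [sqrt_det_ballMetric hy, inv_ballMetric hy, zpow_sub₀ (conformalFactor_pos hy).ne']
  simp [Matrix.one_apply, div_eq_mul_inv, mul_assoc]

theorem partialDeriv_smul_partialDeriv {w : EuclideanSpace ℝ (Fin n) → ℝ}
    {f : EuclideanSpace ℝ (Fin n) → ℂ} (hw : DifferentiableAt ℝ w x) (hf : ContDiffAt ℝ 2 f x)
    (i : Fin n) :
    partialDeriv i (fun y => w y • partialDeriv i f y) x =
      w x • fderiv ℝ (fderiv ℝ f) x (.single i 1) (.single i 1) +
        fderiv ℝ w x (.single i 1) • fderiv ℝ f x (.single i 1) := by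
  have hf' : DifferentiableAt ℝ (fderiv ℝ f) x :=
    (hf.fderiv_right (m := 1) le_rfl).differentiableAt one_ne_zero
  have h := hw.hasFDerivAt.smul (hf'.hasFDerivAt.clm_apply
    (hasFDerivAt_const (EuclideanSpace.single i (1 : ℝ)) x))
  refine (congrArg (fun L => L (EuclideanSpace.single i 1)) h.fderiv).trans ?_
  simp

theorem hypLaplacian_eq_ballLaplacian (hx : x ∈ ball 0 ρ) {f : EuclideanSpace ℝ (Fin n) → ℂ}
    (hf : ContDiffAt ℝ 2 f x) : hypLaplacian ρ f x = ballLaplacian ρ f x := by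
  have hne := (conformalFactor_pos hx).ne'
  have hw := hasFDerivAt_conformalFactor_zpow (n - 2 : ℤ) hx
  have hradial (c : ℝ) :
      ∑ i, (c • innerSL ℝ x) (.single i 1) • fderiv ℝ f x (.single i 1) = c • fderiv ℝ f x x := by
    conv_rhs => arg 2; arg 2; rw [← (EuclideanSpace.basisFun (Fin n) ℝ).sum_repr x]
    simp [EuclideanSpace.inner_single_right, Finset.mul_sum, mul_assoc]
  have hlap : Δ f x = ∑ i, fderiv ℝ (fderiv ℝ f) x (.single i 1) (.single i 1) := by
    simp [laplacian_eq_sum_fderiv_fderiv (EuclideanSpace.basisFun (Fin n) ℝ)]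
  simp only [hypLaplacian_eq_sum_partialDeriv hx, partialDeriv_smul_partialDeriv
    hw.differentiableAt hf, hw.fderiv, Finset.sum_add_distrib, ← Finset.smul_sum, ← hlap]
  rw [hradial, ballLaplacian, finrank_euclideanSpace_fin, zpow_add_one₀ hne, zpow_sub₀ hne,
    zpow_natCast]
  push_cast
  match_scalars
  · field_simp
  · field_simp

end Coordinates

section LogQuadratic

variable {E : Type*} [NormedAddCommGroup E] [InnerProductSpace ℝ E]
  {c : ℝ} {v x : E}

theorem contDiff_norm_sub_sq {N : WithTop ℕ∞} (v : E) : ContDiff ℝ N fun y => ‖y - v‖ ^ 2 :=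
  (contDiff_id.sub contDiff_const).norm_sq ℝ

theorem contDiffAt_log_norm_sub_sq {N : WithTop ℕ∞} (hx : x ≠ v) :
    ContDiffAt ℝ N (fun y => Real.log (‖y - v‖ ^ 2)) x :=
  (contDiff_norm_sub_sq v).contDiffAt.log (pow_ne_zero 2 (norm_ne_zero_iff.2 (sub_ne_zero.2 hx)))

theorem contDiffAt_log_sub_norm_sq {N : WithTop ℕ∞} (hx : ‖x‖ ^ 2 < c) :
    ContDiffAt ℝ N (fun y => Real.log (c - ‖y‖ ^ 2)) x :=
  (contDiffAt_const.sub (contDiff_id.norm_sq ℝ).contDiffAt).log (sub_pos.2 hx).ne'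

theorem deriv_log_const_sub (c : ℝ) :
    deriv (fun s => Real.log (c - s)) = fun s => -(c - s)⁻¹ := by
  ext s
  rw [deriv_comp_const_sub, Real.deriv_log]

section Complete

variable [CompleteSpace E]

theorem gradient_comp_norm_sub_sq {φ : ℝ → ℝ} (hφ : DifferentiableAt ℝ φ (‖x - v‖ ^ 2)) :
    ∇ (fun y => φ (‖y - v‖ ^ 2)) x = (2 * deriv φ (‖x - v‖ ^ 2)) • (x - v) := by
  rw [gradient_comp_real ((contDiff_norm_sub_sq v).differentiable one_ne_zero x) hφ,
    gradient_norm_sub_sq, smul_smul, mul_comm]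

theorem gradient_log_norm_sub_sq (hx : x ≠ v) :
    ∇ (fun y => Real.log (‖y - v‖ ^ 2)) x = (2 / ‖x - v‖ ^ 2) • (x - v) := by
  have hne : ‖x - v‖ ^ 2 ≠ 0 := pow_ne_zero 2 (norm_ne_zero_iff.2 (sub_ne_zero.2 hx))
  rw [gradient_comp_norm_sub_sq (Real.differentiableAt_log hne), Real.deriv_log, div_eq_mul_inv]

theorem gradient_log_sub_norm_sq (hx : ‖x‖ ^ 2 < c) :
    ∇ (fun y => Real.log (c - ‖y‖ ^ 2)) x = -(2 / (c - ‖x‖ ^ 2)) • x := by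
  have hne : c - ‖x - 0‖ ^ 2 ≠ 0 := by simpa using (sub_pos.2 hx).ne'
  have h := gradient_comp_norm_sub_sq (v := 0) (φ := fun s => Real.log (c - s))
    ((differentiableAt_id.const_sub c).log hne)
  simp only [sub_zero, deriv_log_const_sub] at h
  rw [h, mul_neg, div_eq_mul_inv]

end Complete

variable [FiniteDimensional ℝ E]

theorem laplacian_comp_norm_sub_sq {φ : ℝ → ℝ} (hφ : ContDiffAt ℝ 2 φ (‖x - v‖ ^ 2)) :
    Δ (fun y => φ (‖y - v‖ ^ 2)) x = 2 * finrank ℝ E * deriv φ (‖x - v‖ ^ 2) +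
      4 * ‖x - v‖ ^ 2 * deriv (deriv φ) (‖x - v‖ ^ 2) := by
  rw [laplacian_comp_real (contDiff_norm_sub_sq v).contDiffAt hφ, laplacian_norm_sub_sq,
    gradient_norm_sub_sq, norm_smul]
  simp only [smul_eq_mul, Real.norm_ofNat]
  ring

theorem laplacian_log_norm_sub_sq (hx : x ≠ v) :
    Δ (fun y => Real.log (‖y - v‖ ^ 2)) x = (2 * finrank ℝ E - 4) / ‖x - v‖ ^ 2 := by
  have hne : ‖x - v‖ ≠ 0 := norm_ne_zero_iff.2 (sub_ne_zero.2 hx)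
  rw [laplacian_comp_norm_sub_sq (Real.contDiffAt_log.2 (pow_ne_zero 2 hne)), Real.deriv_log',
    deriv_inv]
  field_simp
  ring

theorem laplacian_log_sub_norm_sq (hx : ‖x‖ ^ 2 < c) :
    (Δ fun y : E => Real.log (c - ‖y‖ ^ 2)) x =
      -(2 * finrank ℝ E / (c - ‖x‖ ^ 2)) - 4 * ‖x‖ ^ 2 / (c - ‖x‖ ^ 2) ^ 2 := by
  have hne : c - ‖x - 0‖ ^ 2 ≠ 0 := by simpa using (sub_pos.2 hx).ne'
  have h := laplacian_comp_norm_sub_sq (v := 0) (φ := fun s => Real.log (c - s))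
    ((contDiffAt_const.sub contDiffAt_id).log hne)
  have hsecond : deriv (fun s => -(c - s)⁻¹) (‖x‖ ^ 2) = -((c - ‖x‖ ^ 2) ^ 2)⁻¹ := by
    rw [deriv.fun_neg, deriv_comp_const_sub (f := Inv.inv), deriv_inv, neg_neg]
  simp only [sub_zero, deriv_log_const_sub, hsecond] at h
  rw [h]
  ring

end LogQuadratic

section PoissonKernel

variable {n : ℕ} {ρ : ℝ} {v x : EuclideanSpace ℝ (Fin n)}

theorem sq_norm_sub_pos {E : Type*} [NormedAddCommGroup E] {v x : E} (h : ‖x‖ < ‖v‖) :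
    0 < ‖v - x‖ ^ 2 :=
  pow_pos (norm_sub_pos_iff.2 (ne_of_apply_ne norm h.ne')) 2

theorem omega_pos (h : ‖x‖ < ‖v‖) : 0 < omega v x :=
  div_pos (sub_pos.2 (pow_lt_pow_left₀ h (norm_nonneg x) two_ne_zero)) (sq_norm_sub_pos h)

theorem contDiffOn_omega {N : WithTop ℕ∞} :
    ContDiffOn ℝ N (fun p : EuclideanSpace ℝ (Fin n) × EuclideanSpace ℝ (Fin n) => omega p.1 p.2)
      {p | ‖p.2‖ < ‖p.1‖} :=
  ((contDiff_fst.norm_sq ℝ).sub (contDiff_snd.norm_sq ℝ)).contDiffOn.div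
    ((contDiff_fst.sub contDiff_snd).norm_sq ℝ).contDiffOn fun _ hp => (sq_norm_sub_pos hp).ne'

theorem isOpen_setOf_norm_snd_lt_norm_fst {E F : Type*} [SeminormedAddCommGroup E]
    [SeminormedAddCommGroup F] : IsOpen {p : E × F | ‖p.2‖ < ‖p.1‖} :=
  isOpen_lt continuous_snd.norm continuous_fst.norm

theorem contDiffAt_log_omega {N : WithTop ℕ∞} (h : ‖x‖ < ‖v‖) :
    ContDiffAt ℝ N (fun y => Real.log (omega v y)) x := by
  have homega := (contDiffOn_omega (N := N)).contDiffAt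
    (isOpen_setOf_norm_snd_lt_norm_fst.mem_nhds (show (v, x) ∈ _ from h))
  exact (homega.comp x (contDiffAt_const.prodMk contDiffAt_id)).log (omega_pos h).ne'

theorem log_omega_eventuallyEq (h : ‖x‖ < ‖v‖) :
    (fun y => Real.log (omega v y)) =ᶠ[𝓝 x]
      (fun y => Real.log (‖v‖ ^ 2 - ‖y‖ ^ 2)) - fun y => Real.log (‖y - v‖ ^ 2) := by
  filter_upwards [continuous_norm.continuousAt.eventually_lt_const h] with y hy
  rw [Pi.sub_apply, norm_sub_rev, omega, Real.log_div _ (sq_norm_sub_pos hy).ne']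
  exact (sub_pos.2 (pow_lt_pow_left₀ hy (norm_nonneg y) two_ne_zero)).ne'

theorem gradient_log_omega (h : ‖x‖ < ‖v‖) :
    ∇ (fun y => Real.log (omega v y)) x =
      (2 / ‖x - v‖ ^ 2) • (v - x) - (2 / (‖v‖ ^ 2 - ‖x‖ ^ 2)) • x := by
  have hP : ‖x‖ ^ 2 < ‖v‖ ^ 2 := pow_lt_pow_left₀ h (norm_nonneg x) two_ne_zero
  have hsub : ∇ (fun y => Real.log (omega v y)) x =
      ∇ (fun y => Real.log (‖v‖ ^ 2 - ‖y‖ ^ 2)) x - ∇ (fun y => Real.log (‖y - v‖ ^ 2)) x := by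
    rw [gradient, (log_omega_eventuallyEq h).fderiv_eq,
      fderiv_sub ((contDiffAt_log_sub_norm_sq (N := 1) hP).differentiableAt one_ne_zero)
        ((contDiffAt_log_norm_sub_sq (N := 1) (ne_of_apply_ne norm h.ne)).differentiableAt
          one_ne_zero), map_sub, gradient, gradient]
  rw [hsub, gradient_log_sub_norm_sq hP, gradient_log_norm_sub_sq (ne_of_apply_ne norm h.ne)]
  module

theorem laplacian_log_omega (h : ‖x‖ < ‖v‖) :
    Δ (fun y => Real.log (omega v y)) x =
      -(2 * n / (‖v‖ ^ 2 - ‖x‖ ^ 2)) - 4 * ‖x‖ ^ 2 / (‖v‖ ^ 2 - ‖x‖ ^ 2) ^ 2 -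
        (2 * n - 4) / ‖x - v‖ ^ 2 := by
  have hP : ‖x‖ ^ 2 < ‖v‖ ^ 2 := pow_lt_pow_left₀ h (norm_nonneg x) two_ne_zero
  have hne : x ≠ v := ne_of_apply_ne norm h.ne
  rw [(InnerProductSpace.laplacian_congr_nhds (log_omega_eventuallyEq h)).eq_of_nhds,
    (contDiffAt_log_sub_norm_sq hP).laplacian_sub (contDiffAt_log_norm_sub_sq hne),
    laplacian_log_sub_norm_sq hP, laplacian_log_norm_sub_sq hne, finrank_euclideanSpace_fin]

theorem two_mul_inner_sub_self_right {E : Type*} [NormedAddCommGroup E] [InnerProductSpace ℝ E]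
    (x v : E) :
    2 * ⟪x, v - x⟫_ℝ = ‖v‖ ^ 2 - ‖x‖ ^ 2 - ‖x - v‖ ^ 2 := by
  rw [norm_sub_sq_real, inner_sub_right, real_inner_self_eq_norm_sq]
  ring

theorem norm_gradient_log_omega (h : ‖x‖ < ‖v‖) :
    ‖∇ (fun y => Real.log (omega v y)) x‖ = 2 * ‖v‖ / (‖v‖ ^ 2 - ‖x‖ ^ 2) := by
  have hP : 0 < ‖v‖ ^ 2 - ‖x‖ ^ 2 := sub_pos.2 (pow_lt_pow_left₀ h (norm_nonneg x) two_ne_zero)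
  have hQ : 0 < ‖x - v‖ := norm_sub_pos_iff.2 (ne_of_apply_ne norm h.ne)
  have hinner := two_mul_inner_sub_self_right x v
  rw [gradient_log_omega h, ← sq_eq_sq₀ (norm_nonneg _) (by positivity), norm_sub_sq_real,
    norm_smul, norm_smul, real_inner_smul_left, real_inner_smul_right, real_inner_comm,
    norm_sub_rev v x, Real.norm_of_nonneg (by positivity), Real.norm_of_nonneg (by positivity)]
  field_simp
  linear_combination -(‖v‖ ^ 2 - ‖x‖ ^ 2) * hinner

theorem ballGradientSq_log_omega (hx : x ∈ ball 0 ‖v‖) :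
    ballGradientSq ‖v‖ (fun y => Real.log (omega v y)) x = (‖v‖ ^ 2)⁻¹ := by
  have hv : ‖v‖ ≠ 0 := (pos_of_mem_ball hx).ne'
  have hP := (sq_sub_norm_sq_pos hx).ne'
  rw [ballGradientSq, norm_gradient_log_omega (mem_ball_zero_iff.1 hx), conformalFactor]
  field_simp

theorem ballLaplacian_log_omega (hx : x ∈ ball 0 ‖v‖) :
    ballLaplacian ‖v‖ (fun y => Real.log (omega v y)) x = (1 - n) / ‖v‖ ^ 2 := by
  have h : ‖x‖ < ‖v‖ := mem_ball_zero_iff.1 hx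
  have hv : ‖v‖ ≠ 0 := (pos_of_mem_ball hx).ne'
  have hP := (sq_sub_norm_sq_pos hx).ne'
  have hQ : ‖x - v‖ ≠ 0 := (norm_sub_pos_iff.2 (ne_of_apply_ne norm h.ne)).ne'
  have hinner := two_mul_inner_sub_self_right x v
  rw [ballLaplacian, laplacian_log_omega h, ← inner_gradient_left, gradient_log_omega h,
    inner_sub_left, real_inner_smul_left, real_inner_smul_left, real_inner_self_eq_norm_sq,
    real_inner_comm, finrank_euclideanSpace_fin, conformalFactor]
  simp only [smul_eq_mul]
  field_simp
  linear_combination 2 * (n - 2) * (‖v‖ ^ 2 - ‖x‖ ^ 2) * hinner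

theorem omega_cpow_eq_exp (h : ‖x‖ < ‖v‖) (α : ℂ) :
    (omega v x : ℂ) ^ α = Complex.exp (Real.log (omega v x) * α) := by
  rw [Complex.cpow_def_of_ne_zero (Complex.ofReal_ne_zero.2 (omega_pos h).ne'),
    Complex.ofReal_log (omega_pos h).le]

theorem contDiff_cexp_ofReal_mul {N : WithTop ℕ∞} (α : ℂ) :
    ContDiff ℝ N fun s : ℝ => Complex.exp (s * α) :=
  (Complex.ofRealCLM.contDiff.mul contDiff_const).cexp

theorem deriv_cexp_ofReal_mul (α : ℂ) :
    deriv (fun s : ℝ => Complex.exp (s * α)) = fun s : ℝ => α * Complex.exp (s * α) := by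
  ext s
  have h := (((hasDerivAt_id s).ofReal_comp.mul_const α).cexp).deriv
  simpa [mul_comm] using h

theorem ballLaplacian_omega_cpow (α : ℂ) (hx : x ∈ ball 0 ‖v‖) :
    ballLaplacian ‖v‖ (fun y => (omega v y : ℂ) ^ α) x =
      -((α * (n - 1) - α ^ 2) / ‖v‖ ^ 2) * (omega v x : ℂ) ^ α := by
  have h := mem_ball_zero_iff.1 hx
  have hexp : (fun y => (omega v y : ℂ) ^ α) =ᶠ[𝓝 x]
      fun y => Complex.exp (Real.log (omega v y) * α) := by
    filter_upwards [continuous_norm.continuousAt.eventually_lt_const h] with y hy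
    exact omega_cpow_eq_exp hy α
  rw [ballLaplacian_congr hexp, ballLaplacian_comp_real (f := fun y => Real.log (omega v y))
    (φ := fun s : ℝ => Complex.exp (s * α)) (contDiffAt_log_omega h)
    (contDiff_cexp_ofReal_mul α).contDiffAt, ballGradientSq_log_omega hx,
    ballLaplacian_log_omega hx, omega_cpow_eq_exp h α]
  simp only [deriv_cexp_ofReal_mul, deriv_const_mul_field', Complex.real_smul]
  push_cast
  ring

end PoissonKernel

section RadialDist

variable {ρ s : ℝ}

theorem hasDerivAt_artanh {t : ℝ} (ht : t ∈ Ioo (-1) 1) :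
    HasDerivAt Real.artanh (1 - t ^ 2)⁻¹ t := by
  have hadd : 1 + t ≠ 0 := by linarith [ht.1]
  have hsub : 1 - t ≠ 0 := by linarith [ht.2]
  have hsq : 1 - t ^ 2 ≠ 0 := by
    rw [show 1 - t ^ 2 = (1 + t) * (1 - t) by ring]
    exact mul_ne_zero hadd hsub
  have hlog : HasDerivAt (fun s => 1 / 2 * Real.log ((1 + s) / (1 - s))) (1 - t ^ 2)⁻¹ t := by
    refine (((((hasDerivAt_id t).const_add 1).div ((hasDerivAt_id t).const_sub 1) hsub).log
      (div_ne_zero hadd hsub)).const_mul (1 / 2)).congr_deriv ?_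
    simp only [Pi.div_apply, id]
    field_simp
    ring
  refine hlog.congr_of_eventuallyEq ?_
  filter_upwards [Icc_mem_nhds ht.1 ht.2] with s hs using Real.artanh_eq_half_log hs

/-- The hyperbolic distance between the centre of the ball of radius `ρ` and a point at Euclidean
distance `s` from it, see `hypDist_zero_left`. -/
noncomputable def radialDist (ρ s : ℝ) : ℝ := 2 * ρ * Real.artanh (s / ρ)

theorem div_mem_Ioo_of_mem_ball (hs : s ∈ ball 0 ρ) : s / ρ ∈ Ioo (-1) 1 := by
  rw [mem_ball_zero_iff, Real.norm_eq_abs] at hs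
  rw [mem_Ioo, ← abs_lt, abs_div, abs_of_pos ((abs_nonneg s).trans_lt hs)]
  exact (div_lt_one ((abs_nonneg s).trans_lt hs)).2 hs

theorem radialDist_zero (ρ : ℝ) : radialDist ρ 0 = 0 := by
  rw [radialDist, zero_div, Real.artanh_zero, mul_zero]

theorem mul_tanh_radialDist (hs : s ∈ ball 0 ρ) :
    ρ * Real.tanh (radialDist ρ s / (2 * ρ)) = s := by
  have hρ : ρ ≠ 0 := (pos_of_mem_ball hs).ne'
  rw [radialDist, mul_div_cancel_left₀ _ (mul_ne_zero two_ne_zero hρ),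
    Real.tanh_artanh (div_mem_Ioo_of_mem_ball hs), mul_div_cancel₀ _ hρ]

theorem radialDist_mul_tanh (hρ : ρ ≠ 0) (r : ℝ) :
    radialDist ρ (ρ * Real.tanh (r / (2 * ρ))) = r := by
  rw [radialDist, mul_div_cancel_left₀ _ hρ, Real.artanh_tanh]
  field_simp

theorem hasDerivAt_radialDist (hs : s ∈ ball 0 ρ) :
    HasDerivAt (radialDist ρ) (conformalFactor ρ s) s := by
  have hρ : ρ ≠ 0 := (pos_of_mem_ball hs).ne'
  have hne := (sq_sub_norm_sq_pos hs).ne'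
  refine (((hasDerivAt_artanh (div_mem_Ioo_of_mem_ball hs)).comp s
    ((hasDerivAt_id s).div_const ρ)).const_mul (2 * ρ)).congr_deriv ?_
  rw [Real.norm_eq_abs, sq_abs] at hne
  rw [conformalFactor, Real.norm_eq_abs, sq_abs,
    show 1 - (s / ρ) ^ 2 = (ρ ^ 2 - s ^ 2) / ρ ^ 2 by field_simp]
  field_simp

theorem conformalFactor_le_of_norm_le {E F : Type*} [NormedAddCommGroup E] [NormedAddCommGroup F]
    {x : E} {y : F} (h : ‖x‖ ≤ ‖y‖) (hy : y ∈ ball 0 ρ) :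
    conformalFactor ρ x ≤ conformalFactor ρ y := by
  have hpos := sq_sub_norm_sq_pos hy
  rw [conformalFactor, conformalFactor]
  gcongr

theorem deriv_deriv_radialDist (hs : s ∈ ball 0 ρ) :
    deriv (deriv (radialDist ρ)) s = conformalFactor ρ s ^ 2 / ρ ^ 2 * s := by
  have hderiv : deriv (radialDist ρ) =ᶠ[𝓝 s] conformalFactor ρ := by
    filter_upwards [isOpen_ball.mem_nhds hs] with t ht using (hasDerivAt_radialDist ht).deriv
  rw [hderiv.deriv_eq, ← fderiv_apply_one_eq_deriv, (hasFDerivAt_conformalFactor hs).fderiv]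
  simp

theorem contDiffOn_radialDist {N : ℕ} : ContDiffOn ℝ N (radialDist ρ) (ball 0 ρ) := by
  refine ContDiffOn.of_le (n := N + 1) ?_ (by simp)
  rw [contDiffOn_succ_iff_deriv_of_isOpen isOpen_ball]
  exact ⟨fun s hs => (hasDerivAt_radialDist hs).differentiableAt.differentiableWithinAt, by simp,
    contDiffOn_conformalFactor.congr fun s hs => (hasDerivAt_radialDist hs).deriv⟩

theorem cosh_div_sinh_radialDist (hs : s ∈ ball 0 ρ) (hs0 : s ≠ 0) :
    Real.cosh (radialDist ρ s / ρ) / Real.sinh (radialDist ρ s / ρ) =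
      (ρ ^ 2 + s ^ 2) / (2 * ρ * s) := by
  have hρ : ρ ≠ 0 := (pos_of_mem_ball hs).ne'
  set y := radialDist ρ s / (2 * ρ) with hy
  have hsinh : Real.sinh y = s / ρ * Real.cosh y := by
    rw [← mul_tanh_radialDist hs, Real.tanh_eq_sinh_div_cosh, ← hy]
    field_simp
  have hcosh := (Real.cosh_pos y).ne'
  rw [show radialDist ρ s / ρ = 2 * y by rw [hy]; field_simp, Real.cosh_two_mul,
    Real.sinh_two_mul, hsinh]
  field_simp

end RadialDist

section Distance

variable {n : ℕ} {ρ : ℝ} {m : EuclideanSpace ℝ (Fin n)} {γ : ℝ → EuclideanSpace ℝ (Fin n)}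

theorem sqrt_ballMetric_apply (hm : m ∈ ball 0 ρ) (v : EuclideanSpace ℝ (Fin n)) :
    √(v.ofLp ⬝ᵥ ((ballMetric ρ m).mulVec v.ofLp)) = conformalFactor ρ m * ‖v‖ := by
  have hv : v.ofLp ⬝ᵥ v.ofLp = ‖v‖ ^ 2 := by
    rw [EuclideanSpace.norm_sq_eq]
    simp [dotProduct, sq]
  rw [ballMetric_eq_conformalFactor_sq_smul_one, Matrix.smul_mulVec, Matrix.one_mulVec,
    dotProduct_smul, hv, smul_eq_mul, ← mul_pow,
    Real.sqrt_sq (mul_nonneg (conformalFactor_pos hm).le (norm_nonneg v))]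

theorem pathLength_ballMetric (hmaps : MapsTo γ (Icc 0 1) (ball 0 ρ)) :
    pathLength (ballMetric ρ) γ =
      ∫ t in (0 : ℝ)..1, conformalFactor ρ (γ t) * ‖derivWithin γ (Icc 0 1) t‖ := by
  refine intervalIntegral.integral_congr fun t ht => sqrt_ballMetric_apply (hmaps ?_) _
  rwa [uIcc_of_le zero_le_one] at ht

theorem smul_mem_ball {E : Type*} [NormedAddCommGroup E] [NormedSpace ℝ E] {x : E} {t : ℝ}
    (ht : t ∈ Icc 0 1) (hx : x ∈ ball 0 ρ) : t • x ∈ ball 0 ρ :=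
  (convex_ball 0 ρ).smul_mem_of_zero_mem (mem_ball_self (pos_of_mem_ball hx)) hx ht

theorem continuousOn_conformalFactor_comp {E : Type*} [NormedAddCommGroup E]
    [InnerProductSpace ℝ E] {c : ℝ → E} {S : Set ℝ} (hc : ContinuousOn c S)
    (hmaps : MapsTo c S (ball 0 ρ)) :
    ContinuousOn (fun t => conformalFactor ρ (c t)) S :=
  (contDiffOn_conformalFactor (N := 0)).continuousOn.comp hc hmaps

theorem pathLength_segment (hm : m ∈ ball 0 ρ) :
    pathLength (ballMetric ρ) (fun t => t • m) = radialDist ρ ‖m‖ := by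
  have hmaps : MapsTo (fun t : ℝ => t * ‖m‖) (uIcc 0 1) (ball 0 ρ) := by
    intro t ht
    rw [uIcc_of_le zero_le_one] at ht
    exact smul_mem_ball ht (by simpa using hm)
  have hderiv (t : ℝ) (ht : t ∈ uIcc 0 1) : HasDerivAt (fun t => radialDist ρ (t * ‖m‖))
      (conformalFactor ρ (t * ‖m‖) * ‖m‖) t := by
    simpa only [one_mul, Function.comp_def] using HasDerivAt.comp (h₂ := radialDist ρ) t
      (hasDerivAt_radialDist (hmaps ht)) ((hasDerivAt_id' t).mul_const ‖m‖)
  have hint : ∫ t in (0 : ℝ)..1, conformalFactor ρ (t * ‖m‖) * ‖m‖ = radialDist ρ ‖m‖ := by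
    rw [intervalIntegral.integral_eq_sub_of_hasDerivAt hderiv
      ((continuousOn_conformalFactor_comp (by fun_prop) hmaps).mul
        continuousOn_const).intervalIntegrable]
    simp [radialDist_zero]
  rw [pathLength_ballMetric fun t ht => smul_mem_ball ht hm, ← hint]
  refine intervalIntegral.integral_congr fun t ht => ?_
  rw [uIcc_of_le zero_le_one] at ht
  have hγ := ((hasDerivAt_id t).smul_const m).hasDerivWithinAt (s := Icc 0 1)
  simp only [id, one_smul] at hγ
  simp only [hγ.derivWithin (uniqueDiffOn_Icc zero_lt_one t ht), conformalFactor, norm_smul,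
    norm_mul, norm_norm]

/-- Orthogonal projection onto a diameter does not increase hyperbolic lengths, because it moves
points towards the centre, where the conformal factor is smaller. -/
theorem radialDist_inner_sub_le_pathLength {e : EuclideanSpace ℝ (Fin n)} (he : ‖e‖ ≤ 1)
    (hγ : ContDiffOn ℝ 1 γ (Icc 0 1)) (hmaps : MapsTo γ (Icc 0 1) (ball 0 ρ)) :
    radialDist ρ ⟪e, γ 1⟫_ℝ - radialDist ρ ⟪e, γ 0⟫_ℝ ≤ pathLength (ballMetric ρ) γ := by
  have hproj (y : EuclideanSpace ℝ (Fin n)) : ‖⟪e, y⟫_ℝ‖ ≤ ‖y‖ :=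
    (norm_inner_le_norm e y).trans (mul_le_of_le_one_left (norm_nonneg y) he)
  have hball (t : ℝ) (ht : t ∈ Icc 0 1) : ⟪e, γ t⟫_ℝ ∈ ball 0 ρ :=
    mem_ball_zero_iff.2 ((hproj _).trans_lt (mem_ball_zero_iff.1 (hmaps ht)))
  have hderiv (t : ℝ) (ht : t ∈ Icc 0 1) :
      HasDerivWithinAt (fun t => radialDist ρ ⟪e, γ t⟫_ℝ)
        (conformalFactor ρ ⟪e, γ t⟫_ℝ * ⟪e, derivWithin γ (Icc 0 1) t⟫_ℝ) (Icc 0 1) t := by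
    have hinner : HasDerivWithinAt (fun t => ⟪e, γ t⟫_ℝ) ⟪e, derivWithin γ (Icc 0 1) t⟫_ℝ
        (Icc 0 1) t :=
      (innerSL ℝ e).hasFDerivAt.comp_hasDerivWithinAt t
        (hγ.differentiableOn one_ne_zero t ht).hasDerivWithinAt
    exact HasDerivAt.comp_hasDerivWithinAt (h₂ := radialDist ρ) t
      (hasDerivAt_radialDist (hball t ht)) hinner
  rw [pathLength_ballMetric hmaps]
  refine intervalIntegral.sub_le_integral_of_hasDeriv_right_of_le zero_le_one
    (fun t ht => (hderiv t ht).continuousWithinAt)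
    (fun t ht => (hderiv t (Ioo_subset_Icc_self ht)).mono_of_mem_nhdsWithin
      (mem_nhdsWithin_of_mem_nhds (Icc_mem_nhds ht.1 ht.2))) ?_ fun t ht => ?_
  · exact ((continuousOn_conformalFactor_comp hγ.continuousOn hmaps).mul
      (hγ.continuousOn_derivWithin (uniqueDiffOn_Icc zero_lt_one) le_rfl).norm).integrableOn_Icc
  · have ht' := Ioo_subset_Icc_self ht
    exact (mul_le_mul_of_nonneg_left ((le_abs_self _).trans (hproj _))
      (conformalFactor_pos (hball t ht')).le).trans (mul_le_mul_of_nonneg_right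
        (conformalFactor_le_of_norm_le (hproj _) (hmaps ht')) (norm_nonneg _))

theorem hypDist_zero_left (hm : m ∈ ball 0 ρ) : hypDist ρ 0 m = radialDist ρ ‖m‖ := by
  refine IsLeast.csInf_eq ⟨⟨fun t => t • m, by fun_prop, fun t ht => smul_mem_ball ht hm,
    zero_smul ℝ m, one_smul ℝ m, (pathLength_segment hm).symm⟩, ?_⟩
  rintro L ⟨γ, hγ, hmaps, h0, h1, rfl⟩
  have he : ‖‖m‖⁻¹ • m‖ ≤ 1 := by
    rw [norm_smul, norm_inv, norm_norm]
    exact inv_mul_le_one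
  have hinner : ⟪‖m‖⁻¹ • m, m⟫_ℝ = ‖m‖ := by
    rw [real_inner_smul_left, real_inner_self_eq_norm_sq, pow_two, ← mul_assoc,
      inv_mul_mul_self]
  simpa [h0, h1, hinner, radialDist_zero] using radialDist_inner_sub_le_pathLength he hγ hmaps

theorem norm_eq_mul_tanh_hypDist (hm : m ∈ ball 0 ρ) :
    ‖m‖ = ρ * Real.tanh (hypDist ρ 0 m / (2 * ρ)) := by
  rw [hypDist_zero_left hm, mul_tanh_radialDist (by simpa using hm)]

end Distance

section RadialFunctions

variable {E F : Type*} [NormedAddCommGroup E] [InnerProductSpace ℝ E]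
  [NormedAddCommGroup F] [NormedSpace ℝ F] {ρ : ℝ} {x : E}

theorem contDiffAt_radialDist_norm {N : ℕ} (hx : x ∈ ball 0 ρ) (hx0 : x ≠ 0) :
    ContDiffAt ℝ N (fun y : E => radialDist ρ ‖y‖) x :=
  (contDiffOn_radialDist.contDiffAt (isOpen_ball.mem_nhds (by simpa using hx))).comp x
    (contDiffAt_norm ℝ hx0)

theorem norm_gradient_norm [CompleteSpace E] (hx : x ≠ 0) : ‖∇ (fun y : E => ‖y‖) x‖ = 1 := by
  have : Nontrivial E := ⟨x, 0, hx⟩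
  rw [gradient, LinearIsometryEquiv.norm_map,
    norm_fderiv_norm ((contDiffAt_norm ℝ hx (n := 1)).differentiableAt one_ne_zero)]

theorem ballGradientSq_radialDist_norm [CompleteSpace E] (hx : x ∈ ball 0 ρ) (hx0 : x ≠ 0) :
    ballGradientSq ρ (fun y : E => radialDist ρ ‖y‖) x = 1 := by
  have hnorm : ‖x‖ ∈ ball 0 ρ := by simpa using hx
  have hderiv := hasDerivAt_radialDist hnorm
  rw [ballGradientSq_comp_real ((contDiffAt_norm ℝ hx0 (n := 1)).differentiableAt one_ne_zero)
    hderiv.differentiableAt, hderiv.deriv, ballGradientSq, norm_gradient_norm hx0, one_pow, mul_one,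
    conformalFactor, norm_norm]
  exact mul_inv_cancel₀ (pow_pos (conformalFactor_pos hx) 2).ne'

variable [FiniteDimensional ℝ E]

theorem laplacian_norm (hx : x ≠ 0) : (Δ fun y : E => ‖y‖) x = (finrank ℝ E - 1) / ‖x‖ := by
  have hderiv : deriv (fun s : ℝ => s ^ 2) = fun s => 2 * s := by
    ext s
    simp
  have hsq := laplacian_comp_real (φ := fun s => s ^ 2) (contDiffAt_norm ℝ hx)
    (contDiff_id.pow 2).contDiffAt
  have hnormsq := laplacian_norm_sub_sq (0 : E) x
  simp only [sub_zero] at hnormsq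
  rw [hnormsq, norm_gradient_norm hx, hderiv, deriv_const_mul_field] at hsq
  rw [eq_div_iff (norm_ne_zero_iff.2 hx)]
  simp only [deriv_id'', smul_eq_mul] at hsq
  linarith

theorem ballLaplacian_radialDist_norm (hx : x ∈ ball 0 ρ) (hx0 : x ≠ 0) :
    ballLaplacian ρ (fun y : E => radialDist ρ ‖y‖) x =
      (finrank ℝ E - 1) * ((ρ ^ 2 + ‖x‖ ^ 2) / (2 * ρ ^ 2 * ‖x‖)) := by
  have hρ : ρ ≠ 0 := (pos_of_mem_ball hx).ne'
  have hs : ‖x‖ ∈ ball 0 ρ := by simpa using hx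
  have hne := (sq_sub_norm_sq_pos hx).ne'
  have hnorm : ‖x‖ ≠ 0 := norm_ne_zero_iff.2 hx0
  have hdiff : DifferentiableAt ℝ (fun y : E => ‖y‖) x :=
    (contDiffAt_norm ℝ hx0 (n := 1)).differentiableAt one_ne_zero
  rw [ballLaplacian_comp_real (contDiffAt_norm ℝ hx0)
    (contDiffOn_radialDist.contDiffAt (isOpen_ball.mem_nhds hs)), ballGradientSq, ballLaplacian,
    laplacian_norm hx0, norm_gradient_norm hx0, hdiff.fderiv_norm_self, deriv_deriv_radialDist hs,
    (hasDerivAt_radialDist hs).deriv]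
  simp only [conformalFactor, norm_norm, smul_eq_mul]
  field_simp
  ring

theorem ballLaplacian_comp_radialDist_norm (hx : x ∈ ball 0 ρ) (hx0 : x ≠ 0) {ψ : ℝ → F}
    (hψ : ContDiffAt ℝ 2 ψ (radialDist ρ ‖x‖)) :
    ballLaplacian ρ (fun y : E => ψ (radialDist ρ ‖y‖)) x =
      deriv (deriv ψ) (radialDist ρ ‖x‖) +
        ((finrank ℝ E - 1) / ρ * (Real.cosh (radialDist ρ ‖x‖ / ρ) /
          Real.sinh (radialDist ρ ‖x‖ / ρ))) • deriv ψ (radialDist ρ ‖x‖) := by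
  have hρ : ρ ≠ 0 := (pos_of_mem_ball hx).ne'
  rw [ballLaplacian_comp_real (f := fun y : E => radialDist ρ ‖y‖)
    (contDiffAt_radialDist_norm hx hx0) hψ, ballGradientSq_radialDist_norm hx hx0, one_smul,
    ballLaplacian_radialDist_norm hx hx0, cosh_div_sinh_radialDist (by simpa using hx)
    (norm_ne_zero_iff.2 hx0)]
  congr 2
  field_simp

end RadialFunctions

section SturmLiouville

variable {a b c δ : ℝ} {w : ℝ → ℝ} {q g v : ℝ → ℂ} {s : Set ℝ} {l : ℂ}

/-- `g` solves the Sturm–Liouville equation `(w g')' + q g = 0` on `s`. Only the products `w g'`,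
not `g'` itself, are required to be differentiable. -/
def IsSturmLiouvilleSolutionOn (w : ℝ → ℝ) (q g : ℝ → ℂ) (s : Set ℝ) : Prop :=
  ∀ t ∈ s, DifferentiableAt ℝ g t ∧ HasDerivAt (fun r => w r • deriv g r) (-(q t * g t)) t

theorem IsSturmLiouvilleSolutionOn.mono {s' : Set ℝ} (hg : IsSturmLiouvilleSolutionOn w q g s)
    (hs : s' ⊆ s) : IsSturmLiouvilleSolutionOn w q g s' :=
  fun t ht => hg t (hs ht)

theorem IsSturmLiouvilleSolutionOn.hasDerivAt_prodMk (hg : IsSturmLiouvilleSolutionOn w q g s)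
    {t : ℝ} (ht : t ∈ s) (hw : w t ≠ 0) :
    HasDerivAt (fun r => (g r, w r • deriv g r)) ((w t)⁻¹ • w t • deriv g t, -(q t * g t)) t := by
  rw [inv_smul_smul₀ hw]
  exact (hg t ht).1.hasDerivAt.prodMk (hg t ht).2

theorem exists_lipschitzWith_sturmLiouville (hw : ContinuousOn w (Icc a b))
    (hw0 : ∀ t ∈ Icc a b, w t ≠ 0) (hq : ContinuousOn q (Icc a b)) :
    ∃ K, ∀ t ∈ Icc a b, LipschitzWith K fun Y : ℂ × ℂ => ((w t)⁻¹ • Y.2, -(q t * Y.1)) := by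
  obtain ⟨K₁, hK₁⟩ := isCompact_Icc.exists_bound_of_continuousOn (hw.inv₀ hw0)
  obtain ⟨K₂, hK₂⟩ := isCompact_Icc.exists_bound_of_continuousOn hq.neg
  refine ⟨max K₁.toNNReal K₂.toNNReal, fun t ht => ?_⟩
  have hfst := ((lipschitzWith_smul (w t)⁻¹).comp
    (LipschitzWith.prod_snd (α := ℂ) (β := ℂ))).weaken (K' := K₁.toNNReal)
    (by simpa only [mul_one] using NNReal.le_toNNReal_of_coe_le (x := ‖(w t)⁻¹‖₊) (hK₁ t ht))
  have hsnd := ((lipschitzWith_smul (-q t)).comp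
    (LipschitzWith.prod_fst (α := ℂ) (β := ℂ))).weaken (K' := K₂.toNNReal)
    (by simpa only [mul_one] using NNReal.le_toNNReal_of_coe_le (x := ‖-q t‖₊) (hK₂ t ht))
  simpa [Function.comp_def] using hfst.prodMk hsnd

theorem IsSturmLiouvilleSolutionOn.eqOn_Icc (hw : ContinuousOn w (Icc a b))
    (hw0 : ∀ t ∈ Icc a b, w t ≠ 0) (hq : ContinuousOn q (Icc a b))
    (hg : IsSturmLiouvilleSolutionOn w q g (Icc a b))
    (hv : IsSturmLiouvilleSolutionOn w q v (Icc a b))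
    (h0 : g a = v a) (h1 : deriv g a = deriv v a) : EqOn g v (Icc a b) := by
  obtain ⟨K, hK⟩ := exists_lipschitzWith_sturmLiouville hw hw0 hq
  have hsys {f : ℝ → ℂ} (hf : IsSturmLiouvilleSolutionOn w q f (Icc a b)) (t : ℝ)
      (ht : t ∈ Icc a b) := hf.hasDerivAt_prodMk ht (hw0 t ht)
  have heq := ODE_solution_unique_of_mem_Icc_right
    (v := fun t (Y : ℂ × ℂ) => ((w t)⁻¹ • Y.2, -(q t * Y.1))) (s := fun _ => univ)
    (fun t ht => (hK t (Ico_subset_Icc_self ht)).lipschitzOnWith)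
    (fun t ht => (hsys hg t ht).continuousAt.continuousWithinAt)
    (fun t ht => (hsys hg t (Ico_subset_Icc_self ht)).hasDerivWithinAt) (fun _ _ => mem_univ _)
    (fun t ht => (hsys hv t ht).continuousAt.continuousWithinAt)
    (fun t ht => (hsys hv t (Ico_subset_Icc_self ht)).hasDerivWithinAt) (fun _ _ => mem_univ _)
    (by simp only [h0, h1])
  exact fun t ht => congrArg Prod.fst (heq ht)

theorem IsSturmLiouvilleSolutionOn.exists_wronskian_eq
    (hg : IsSturmLiouvilleSolutionOn w q g (Ioo a b))
    (hv : IsSturmLiouvilleSolutionOn w q v (Ioo a b)) :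
    ∃ C : ℂ, ∀ t ∈ Ioo a b, w t * (deriv g t * v t - g t * deriv v t) = C := by
  have hderiv (t : ℝ) (ht : t ∈ Ioo a b) :
      HasDerivAt (fun r => w r * (deriv g r * v r - g r * deriv v r)) 0 t := by
    have h := ((hg t ht).2.mul (hv t ht).1.hasDerivAt).sub
      ((hg t ht).1.hasDerivAt.mul (hv t ht).2)
    refine (h.congr_deriv ?_).congr_of_eventuallyEq (.of_forall fun r => ?_)
    all_goals
      simp only [Complex.real_smul, Pi.sub_apply, Pi.mul_apply]
      ring
  exact isOpen_Ioo.exists_is_const_of_deriv_eq_zero isPreconnected_Ioo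
    (fun t ht => (hderiv t ht).differentiableAt.differentiableWithinAt)
    fun t ht => (hderiv t ht).deriv

theorem tendsto_atBot_of_div_le_deriv {h h' : ℝ → ℝ} (hc : 0 < c) (hδ : 0 < δ)
    (hh : ∀ t ∈ Ioo 0 δ, HasDerivAt h (h' t) t) (hle : ∀ t ∈ Ioo 0 δ, c / t ≤ h' t) :
    Tendsto h (𝓝[>] 0) atBot := by
  have hderiv (t : ℝ) (ht : t ∈ Ioo 0 δ) :
      HasDerivAt (fun r => h r - c * Real.log r) (h' t - c * t⁻¹) t :=
    (hh t ht).sub ((Real.hasDerivAt_log ht.1.ne').const_mul c)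
  have hmono : MonotoneOn (fun r => h r - c * Real.log r) (Ioo 0 δ) := by
    refine monotoneOn_of_hasDerivWithinAt_nonneg (convex_Ioo 0 δ)
      (fun t ht => (hderiv t ht).continuousAt.continuousWithinAt)
      (fun t ht => (hderiv t (interior_subset ht)).hasDerivWithinAt) fun t ht => ?_
    rw [← div_eq_mul_inv]
    exact sub_nonneg.2 (hle t (interior_subset ht))
  have hmid : δ / 2 ∈ Ioo 0 δ := ⟨half_pos hδ, half_lt_self hδ⟩
  refine tendsto_atBot_mono' _ ?_ (tendsto_atBot_add_const_right _
    (h (δ / 2) - c * Real.log (δ / 2)) (Real.tendsto_log_nhdsGT_zero.const_mul_atBot hc))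
  filter_upwards [Ioo_mem_nhdsGT hmid.1] with t ht
  linarith [hmono ⟨ht.1, ht.2.trans hmid.2⟩ hmid ht.2.le]

/-- A nonzero constant would make `h` diverge logarithmically. -/
theorem eq_zero_of_tendsto_of_hasDerivAt_div {K : ℝ} {h z : ℝ → ℂ} {C m : ℂ} (hδ : 0 < δ)
    (hw : ∀ t ∈ Ioo 0 δ, 0 < w t) (hwK : ∀ t ∈ Ioo 0 δ, w t ≤ K * t)
    (hz : Tendsto z (𝓝[>] 0) (𝓝 m)) (hm : m ≠ 0)
    (hh : ∀ t ∈ Ioo 0 δ, HasDerivAt h (C / (w t * z t)) t)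
    (hl : Tendsto h (𝓝[>] 0) (𝓝 l)) : C = 0 := by
  by_contra hC
  have hratio : ∀ᶠ t in 𝓝[>] (0 : ℝ), 1 / 2 < (m / z t).re := by
    have hlim : Tendsto (fun t => (m / z t).re) (𝓝[>] 0) (𝓝 (m / m).re) :=
      (Complex.continuous_re.tendsto _).comp (tendsto_const_nhds.div hz hm)
    rw [div_self hm, Complex.one_re] at hlim
    exact hlim.eventually_const_lt (by norm_num)
  obtain ⟨ε, hε, hsub⟩ := mem_nhdsGT_iff_exists_Ioo_subset.1 (hratio.and (Ioo_mem_nhdsGT hδ))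
  have hK : 0 < K := by
    have hmid : δ / 2 ∈ Ioo 0 δ := ⟨half_pos hδ, half_lt_self hδ⟩
    exact pos_of_mul_pos_left ((hw _ hmid).trans_le (hwK _ hmid)) hmid.1.le
  have hderiv (t : ℝ) (ht : t ∈ Ioo 0 ε) :
      HasDerivAt (fun r => (starRingEnd ℂ C * m * h r).re) (‖C‖ ^ 2 / w t * (m / z t).re) t := by
    have hre : (starRingEnd ℂ C * m * (C / (w t * z t))).re = ‖C‖ ^ 2 / w t * (m / z t).re := by
      rw [← Complex.re_ofReal_mul]
      push_cast
      rw [← Complex.conj_mul']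
      congr 1
      ring
    exact (Complex.reCLM.hasFDerivAt.comp_hasDerivAt t
      ((hh t (hsub ht).2).const_mul _)).congr_deriv hre
  have hbot := tendsto_atBot_of_div_le_deriv (c := ‖C‖ ^ 2 / (2 * K)) (by positivity) hε hderiv
    fun t ht => by
      have hwt := hw t (hsub ht).2
      have ht0 : 0 < t := ht.1
      calc ‖C‖ ^ 2 / (2 * K) / t = ‖C‖ ^ 2 / (K * t) * (1 / 2) := by field_simp
        _ ≤ ‖C‖ ^ 2 / w t * (m / z t).re := by
          gcongr
          exacts [hwK t (hsub ht).2, (hsub ht).1.le]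
  exact not_tendsto_atBot_of_tendsto_nhds
    ((Complex.continuous_re.tendsto _).comp (hl.const_mul (starRingEnd ℂ C * m))) hbot

/-- The quotient `g / v` has derivative `C / (w v ^ 2)`, where `C` is the Wronskian. -/
theorem IsSturmLiouvilleSolutionOn.eventuallyEq_nhdsGT {K : ℝ} (hδ : 0 < δ)
    (hw : ∀ t ∈ Ioo 0 δ, 0 < w t) (hwK : ∀ t ∈ Ioo 0 δ, w t ≤ K * t)
    (hg : IsSturmLiouvilleSolutionOn w q g (Ioo 0 δ))
    (hv : IsSturmLiouvilleSolutionOn w q v (Ioo 0 δ)) (hl : l ≠ 0)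
    (hgl : Tendsto g (𝓝[>] 0) (𝓝 l)) (hvl : Tendsto v (𝓝[>] 0) (𝓝 l)) :
    g =ᶠ[𝓝[>] 0] v := by
  obtain ⟨C, hC⟩ := hg.exists_wronskian_eq hv
  obtain ⟨ε, hε, hsub⟩ := mem_nhdsGT_iff_exists_Ioo_subset.1
    ((hvl.eventually_ne hl).and (Ioo_mem_nhdsGT hδ))
  have hquot (t : ℝ) (ht : t ∈ Ioo 0 ε) :
      HasDerivAt (fun r => g r / v r) (C / (w t * v t ^ 2)) t := by
    have ht' := (hsub ht).2
    refine ((hg t ht').1.hasDerivAt.div (hv t ht').1.hasDerivAt (hsub ht).1).congr_deriv ?_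
    rw [← hC t ht', mul_div_mul_left _ _ (Complex.ofReal_ne_zero.2 (hw t ht').ne')]
  have hlim : Tendsto (fun r => g r / v r) (𝓝[>] 0) (𝓝 1) := by
    simpa only [div_self hl, Pi.div_def] using hgl.div hvl hl
  have hC0 : C = 0 := eq_zero_of_tendsto_of_hasDerivAt_div hε (fun t ht => hw t (hsub ht).2)
    (fun t ht => hwK t (hsub ht).2) (hvl.pow 2) (pow_ne_zero 2 hl) hquot hlim
  obtain ⟨D, hD⟩ := isOpen_Ioo.exists_is_const_of_deriv_eq_zero isPreconnected_Ioo
    (fun t ht => (hquot t ht).differentiableAt.differentiableWithinAt)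
    fun t ht => by rw [(hquot t ht).deriv, hC0, zero_div, Pi.zero_apply]
  have hconst : (fun r => g r / v r) =ᶠ[𝓝[>] 0] fun _ => D := by
    filter_upwards [Ioo_mem_nhdsGT hε] with t ht using hD t ht
  have hD1 : D = 1 := tendsto_nhds_unique tendsto_const_nhds (hlim.congr' hconst)
  filter_upwards [hconst, hvl.eventually_ne hl] with t ht hvt
  rwa [hD1, div_eq_one_iff_eq hvt] at ht

theorem IsSturmLiouvilleSolutionOn.eqOn_Ioo {K : ℝ} (hδ : 0 < δ) (hδb : δ ≤ b)
    (hw : ContinuousOn w (Ioo 0 b)) (hw0 : ∀ t ∈ Ioo 0 b, 0 < w t)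
    (hwK : ∀ t ∈ Ioo 0 δ, w t ≤ K * t) (hq : ContinuousOn q (Ioo 0 b))
    (hg : IsSturmLiouvilleSolutionOn w q g (Ioo 0 b))
    (hv : IsSturmLiouvilleSolutionOn w q v (Ioo 0 b)) (hl : l ≠ 0)
    (hgl : Tendsto g (𝓝[>] 0) (𝓝 l)) (hvl : Tendsto v (𝓝[>] 0) (𝓝 l)) :
    EqOn g v (Ioo 0 b) := by
  have hδsub : Ioo 0 δ ⊆ Ioo 0 b := Ioo_subset_Ioo_right hδb
  obtain ⟨ε, hε, hnear⟩ := mem_nhdsGT_iff_exists_Ioo_subset.1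
    ((hg.mono hδsub).eventuallyEq_nhdsGT hδ (fun t ht => hw0 t (hδsub ht)) hwK (hv.mono hδsub)
      hl hgl hvl)
  intro t ht
  obtain ⟨a, ha0, ha⟩ := exists_between (lt_min hε ht.1)
  have hsub : Icc a t ⊆ Ioo 0 b := Icc_subset_Ioo ha0 ht.2
  have hgv : g =ᶠ[𝓝 a] v :=
    mem_of_superset (Ioo_mem_nhds ha0 (ha.trans_le (min_le_left _ _))) hnear
  exact (hg.mono hsub).eqOn_Icc (hw.mono hsub) (fun r hr => (hw0 r (hsub hr)).ne')
    (hq.mono hsub) (hv.mono hsub) hgv.eq_of_nhds hgv.deriv_eq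
    ⟨(ha.trans_le (min_le_right _ _)).le, le_rfl⟩

end SturmLiouville

section ParametricIntegral

universe w

variable {F : Type*} {E G : Type w} [NormedAddCommGroup F] [NormedAddCommGroup E]
  [NormedAddCommGroup G] {S : Set F} {Φ : E → F → G} {y : E}

theorem exists_eventually_forall_norm_le (hS : IsCompact S)
    (hΦ : ∀ v ∈ S, ContinuousAt Φ.uncurry (y, v)) : ∃ C, ∀ᶠ z in 𝓝 y, ∀ v ∈ S, ‖Φ z v‖ ≤ C := by
  have hcont : ContinuousOn (Φ y) S := fun v hv =>
    ((hΦ v hv).comp (f := fun v => (y, v)) (by fun_prop)).continuousWithinAt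
  obtain ⟨C, hC⟩ := hS.exists_bound_of_continuousOn hcont
  exact ⟨C + 1, hS.eventually_forall_of_forall_eventually fun v hv =>
    (hΦ v hv).norm.eventually_le_const ((hC v hv).trans_lt (lt_add_one C))⟩

theorem contDiffAt_uncurry_fderiv [NormedSpace ℝ E] [NormedSpace ℝ F] [NormedSpace ℝ G]
    {m n : WithTop ℕ∞} {v : F}
    (hΦ : ContDiffAt ℝ n Φ.uncurry (y, v)) (hmn : m + 1 ≤ n) :
    ContDiffAt ℝ m (Function.uncurry fun z v => fderiv ℝ (fun z => Φ z v) z) (y, v) :=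
  ContDiffAt.fderiv (f := fun p z => Φ z p.2) (g := Prod.fst)
    (hΦ.comp (((y, v), y) : (E × F) × E) (f := fun q => (q.2, q.1.2))
      (contDiffAt_snd.prodMk (contDiffAt_snd.comp _ contDiffAt_fst))) contDiffAt_fst hmn

variable [MeasurableSpace F] [OpensMeasurableSpace F] {ν : Measure F} [IsFiniteMeasureOnCompacts ν]

theorem integrableOn_of_continuousAt_uncurry (hS : IsCompact S)
    (hΦ : ∀ v ∈ S, ContinuousAt Φ.uncurry (y, v)) : IntegrableOn (Φ y) S ν :=
  ContinuousOn.integrableOn_compact hS fun v hv =>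
    ((hΦ v hv).comp (f := fun v => (y, v)) (by fun_prop)).continuousWithinAt

variable [NormedSpace ℝ G]

theorem continuousAt_setIntegral (hS : IsCompact S)
    (hΦ : ∀ v ∈ S, ∀ᶠ p in 𝓝 (y, v), ContinuousAt Φ.uncurry p) :
    ContinuousAt (fun z => ∫ v in S, Φ z v ∂ν) y := by
  have hΦy : ∀ v ∈ S, ContinuousAt Φ.uncurry (y, v) := fun v hv => (hΦ v hv).self_of_nhds
  obtain ⟨C, hC⟩ := exists_eventually_forall_norm_le hS hΦy
  refine continuousAt_of_dominated (bound := fun _ => C) ?_ ?_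
    (integrableOn_const hS.measure_ne_top) ?_
  · filter_upwards [hS.eventually_forall_of_forall_eventually
      (P := fun z v => ContinuousAt Φ.uncurry (z, v)) hΦ] with z hz
    exact (integrableOn_of_continuousAt_uncurry hS hz).aestronglyMeasurable
  · filter_upwards [hC] with z hz using ae_restrict_of_forall_mem hS.measurableSet hz
  · exact ae_restrict_of_forall_mem hS.measurableSet fun v hv =>
      (hΦy v hv).comp (f := fun z => (z, v)) (by fun_prop)

variable [NormedSpace ℝ E] [NormedSpace ℝ F]

theorem integrableOn_fderiv (hS : IsCompact S) (hΦ : ∀ v ∈ S, ContDiffAt ℝ 1 Φ.uncurry (y, v)) :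
    IntegrableOn (fun v => fderiv ℝ (fun z => Φ z v) y) S ν :=
  integrableOn_of_continuousAt_uncurry (Φ := fun z v => fderiv ℝ (fun z => Φ z v) z) hS fun v hv =>
    (contDiffAt_uncurry_fderiv (m := 0) (hΦ v hv) (by simp)).continuousAt

theorem hasFDerivAt_setIntegral (hS : IsCompact S)
    (hΦ : ∀ v ∈ S, ContDiffAt ℝ 1 Φ.uncurry (y, v)) :
    HasFDerivAt (fun z => ∫ v in S, Φ z v ∂ν) (∫ v in S, fderiv ℝ (fun z => Φ z v) y ∂ν) y := by
  have hnear : ∀ᶠ z in 𝓝 y, ∀ v ∈ S, ContDiffAt ℝ 1 Φ.uncurry (z, v) :=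
    hS.eventually_forall_of_forall_eventually fun v hv => (hΦ v hv).eventually (by simp)
  obtain ⟨C, hC⟩ := exists_eventually_forall_norm_le
    (Φ := fun z v => fderiv ℝ (fun z => Φ z v) z) hS fun v hv =>
      (contDiffAt_uncurry_fderiv (m := 0) (hΦ v hv) (by simp)).continuousAt
  have hs : {z | (∀ v ∈ S, ContDiffAt ℝ 1 Φ.uncurry (z, v)) ∧
      ∀ v ∈ S, ‖fderiv ℝ (fun z => Φ z v) z‖ ≤ C} ∈ 𝓝 y := hnear.and hC
  refine hasFDerivAt_integral_of_dominated_of_fderiv_le (𝕜 := ℝ) (F := Φ)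
    (F' := fun z v => fderiv ℝ (fun z => Φ z v) z) (bound := fun _ => C) hs ?_ ?_ ?_ ?_
    (integrableOn_const (μ := ν) hS.measure_ne_top) ?_
  · filter_upwards [hnear] with z hz
    exact (integrableOn_of_continuousAt_uncurry hS fun v hv =>
      (hz v hv).continuousAt).aestronglyMeasurable
  · exact integrableOn_of_continuousAt_uncurry hS fun v hv => (hΦ v hv).continuousAt
  · exact (integrableOn_fderiv hS hΦ).aestronglyMeasurable
  · exact ae_restrict_of_forall_mem hS.measurableSet fun v hv z hz => hz.2 v hv
  · exact ae_restrict_of_forall_mem hS.measurableSet fun v hv z hz =>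
      (((hz.1 v hv).differentiableAt one_ne_zero).comp z (f := fun z => (z, v))
        (by fun_prop)).hasFDerivAt

theorem eventually_hasFDerivAt_setIntegral (hS : IsCompact S)
    (hΦ : ∀ v ∈ S, ContDiffAt ℝ 1 Φ.uncurry (y, v)) :
    ∀ᶠ z in 𝓝 y, HasFDerivAt (fun z => ∫ v in S, Φ z v ∂ν)
      (∫ v in S, fderiv ℝ (fun z => Φ z v) z ∂ν) z :=
  (hS.eventually_forall_of_forall_eventually fun v hv => (hΦ v hv).eventually (by simp)).mono
    fun _ hz => hasFDerivAt_setIntegral hS hz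

theorem contDiffAt_setIntegral {n : ℕ} (hS : IsCompact S)
    (hΦ : ∀ v ∈ S, ContDiffAt ℝ n Φ.uncurry (y, v)) :
    ContDiffAt ℝ n (fun z => ∫ v in S, Φ z v ∂ν) y := by
  induction n generalizing G with
  | zero =>
    have hnear : ∀ᶠ z in 𝓝 y, ∀ v ∈ S, ContDiffAt ℝ 0 Φ.uncurry (z, v) :=
      hS.eventually_forall_of_forall_eventually fun v hv => (hΦ v hv).eventually (by simp)
    exact contDiffAt_zero.2 ⟨_, hnear, fun z hz => (continuousAt_setIntegral hS fun v hv =>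
      ((hz v hv).eventually (by simp)).mono fun p hp => hp.continuousAt).continuousWithinAt⟩
  | succ n ih =>
    have hΦ1 : ∀ v ∈ S, ContDiffAt ℝ 1 Φ.uncurry (y, v) := fun v hv =>
      (hΦ v hv).of_le (by exact_mod_cast Nat.le_add_left 1 n)
    exact contDiffAt_succ_iff_hasFDerivAt.2 ⟨_, ⟨_, eventually_hasFDerivAt_setIntegral hS hΦ1,
      fun _ hz => hz⟩, ih fun v hv => contDiffAt_uncurry_fderiv (hΦ v hv) (by simp)⟩

theorem fderiv_fderiv_setIntegral (hS : IsCompact S)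
    (hΦ : ∀ v ∈ S, ContDiffAt ℝ 2 Φ.uncurry (y, v)) :
    fderiv ℝ (fderiv ℝ fun z => ∫ v in S, Φ z v ∂ν) y =
      ∫ v in S, fderiv ℝ (fderiv ℝ fun z => Φ z v) y ∂ν := by
  have hfst : (fderiv ℝ fun z => ∫ v in S, Φ z v ∂ν) =ᶠ[𝓝 y]
      fun z => ∫ v in S, fderiv ℝ (fun z => Φ z v) z ∂ν :=
    (eventually_hasFDerivAt_setIntegral hS fun v hv => (hΦ v hv).of_le one_le_two).mono
      fun _ hz => hz.fderiv
  rw [hfst.fderiv_eq]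
  exact (hasFDerivAt_setIntegral hS fun v hv =>
    contDiffAt_uncurry_fderiv (hΦ v hv) (by norm_num)).fderiv

theorem integrableOn_fderiv_fderiv_apply (hS : IsCompact S)
    (hΦ : ∀ v ∈ S, ContDiffAt ℝ 2 Φ.uncurry (y, v)) (e : E) :
    IntegrableOn (fun v => fderiv ℝ (fderiv ℝ fun z => Φ z v) y e e) S ν :=
  ((integrableOn_fderiv hS fun v hv => contDiffAt_uncurry_fderiv (m := 1) (hΦ v hv)
    (by norm_num)).apply_continuousLinearMap e).apply_continuousLinearMap e

end ParametricIntegral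

section LaplacianIntegral

universe w

variable {F : Type*} {E G : Type w} [NormedAddCommGroup F] [NormedSpace ℝ F] [MeasurableSpace F]
  [OpensMeasurableSpace F] [NormedAddCommGroup E] [InnerProductSpace ℝ E] [FiniteDimensional ℝ E]
  [NormedAddCommGroup G] [NormedSpace ℝ G] {S : Set F} {ν : Measure F}
  [IsFiniteMeasureOnCompacts ν] {Φ : E → F → G} {y : E}

theorem laplacian_setIntegral (hS : IsCompact S)
    (hΦ : ∀ v ∈ S, ContDiffAt ℝ 2 Φ.uncurry (y, v)) :
    (Δ fun z => ∫ v in S, Φ z v ∂ν) y = ∫ v in S, (Δ fun z => Φ z v) y ∂ν := by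
  have hint := integrableOn_fderiv (ν := ν) hS fun v hv => contDiffAt_uncurry_fderiv (m := 1)
    (hΦ v hv) (by norm_num)
  simp only [laplacian_eq_sum_fderiv_fderiv (stdOrthonormalBasis ℝ E),
    fderiv_fderiv_setIntegral hS hΦ]
  rw [integral_finsetSum _ fun i _ => integrableOn_fderiv_fderiv_apply hS hΦ _]
  refine Finset.sum_congr rfl fun i _ => ?_
  rw [ContinuousLinearMap.integral_apply hint,
    ContinuousLinearMap.integral_apply (hint.apply_continuousLinearMap _)]

theorem ballLaplacian_setIntegral (ρ : ℝ) (hS : IsCompact S)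
    (hΦ : ∀ v ∈ S, ContDiffAt ℝ 2 Φ.uncurry (y, v)) :
    ballLaplacian ρ (fun z => ∫ v in S, Φ z v ∂ν) y =
      ∫ v in S, ballLaplacian ρ (fun z => Φ z v) y ∂ν := by
  have hΦ1 : ∀ v ∈ S, ContDiffAt ℝ 1 Φ.uncurry (y, v) := fun v hv => (hΦ v hv).of_le one_le_two
  have hint := integrableOn_fderiv (ν := ν) hS hΦ1
  have hΔ : IntegrableOn (fun v => (Δ fun z => Φ z v) y) S ν := by
    simp only [laplacian_eq_sum_fderiv_fderiv (stdOrthonormalBasis ℝ E)]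
    exact integrable_finsetSum _ fun i _ => integrableOn_fderiv_fderiv_apply hS hΦ _
  simp only [ballLaplacian]
  rw [laplacian_setIntegral hS hΦ, (hasFDerivAt_setIntegral hS hΦ1).fderiv,
    ContinuousLinearMap.integral_apply hint, integral_smul, integral_add hΔ
    ((hint.apply_continuousLinearMap y).fun_smul _), integral_smul]

end LaplacianIntegral

section GeodesicRay

variable {n : ℕ} {ρ r : ℝ} {e : EuclideanSpace ℝ (Fin n)} {ψ : ℝ → ℂ}

/-- The hyperbolic geodesic ray from the origin with direction `e`, parametrized for `‖e‖ = 1` by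
hyperbolic arc length. -/
noncomputable def geodesicRay (ρ : ℝ) (e : EuclideanSpace ℝ (Fin n)) (r : ℝ) :
    EuclideanSpace ℝ (Fin n) :=
  (ρ * Real.tanh (r / (2 * ρ))) • e

theorem geodesicRay_zero (ρ : ℝ) (e : EuclideanSpace ℝ (Fin n)) : geodesicRay ρ e 0 = 0 := by
  simp [geodesicRay]

theorem contDiff_geodesicRay {N : WithTop ℕ∞} : ContDiff ℝ N (geodesicRay ρ e) := by
  have htanh : ContDiff ℝ N Real.tanh := by
    rw [funext Real.tanh_eq_sinh_div_cosh]
    exact Real.contDiff_sinh.div Real.contDiff_cosh fun x => (Real.cosh_pos x).ne'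
  exact (contDiff_const.mul (htanh.comp (contDiff_id.div_const _))).smul contDiff_const

theorem norm_geodesicRay (hρ : 0 < ρ) (he : ‖e‖ = 1) (hr : 0 ≤ r) :
    ‖geodesicRay ρ e r‖ = ρ * Real.tanh (r / (2 * ρ)) := by
  have htanh : 0 ≤ Real.tanh (r / (2 * ρ)) := by
    rw [Real.tanh_eq_sinh_div_cosh]
    exact div_nonneg (Real.sinh_nonneg_iff.2 (by positivity)) (Real.cosh_pos _).le
  rw [geodesicRay, norm_smul, he, mul_one, Real.norm_of_nonneg (mul_nonneg hρ.le htanh)]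

theorem geodesicRay_mem_ball (hρ : 0 < ρ) (he : ‖e‖ = 1) (hr : 0 ≤ r) :
    geodesicRay ρ e r ∈ ball 0 ρ := by
  rw [mem_ball_zero_iff, norm_geodesicRay hρ he hr]
  exact mul_lt_of_lt_one_right hρ (Real.tanh_lt_one _)

theorem hypDist_zero_geodesicRay (hρ : 0 < ρ) (he : ‖e‖ = 1) (hr : 0 ≤ r) :
    hypDist ρ 0 (geodesicRay ρ e r) = r := by
  rw [hypDist_zero_left (geodesicRay_mem_ball hρ he hr), norm_geodesicRay hρ he hr,
    radialDist_mul_tanh hρ.ne']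

theorem geodesicRay_ne_zero (hρ : 0 < ρ) (he : ‖e‖ = 1) (hr : 0 < r) : geodesicRay ρ e r ≠ 0 := by
  intro h
  have hdist := hypDist_zero_geodesicRay hρ he hr.le
  rw [h, hypDist_zero_left (mem_ball_self hρ), norm_zero, radialDist_zero] at hdist
  exact hr.ne hdist

theorem contDiffAt_of_comp_hypDist {N : WithTop ℕ∞} (hρ : 0 < ρ) (he : ‖e‖ = 1) (hr : 0 < r)
    (hψ : ContDiffAt ℝ N (fun m => ψ (hypDist ρ 0 m)) (geodesicRay ρ e r)) :
    ContDiffAt ℝ N ψ r := by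
  refine (hψ.comp r contDiff_geodesicRay.contDiffAt).congr_of_eventuallyEq ?_
  filter_upwards [eventually_gt_nhds hr] with t ht
  exact congrArg ψ (hypDist_zero_geodesicRay hρ he ht.le).symm

theorem continuousWithinAt_of_comp_hypDist (hρ : 0 < ρ) (he : ‖e‖ = 1)
    (hψ : ContinuousAt (fun m : EuclideanSpace ℝ (Fin n) => ψ (hypDist ρ 0 m)) 0) :
    ContinuousWithinAt ψ (Ici 0) 0 := by
  have hcomp : ContinuousAt (fun t => ψ (hypDist ρ 0 (geodesicRay ρ e t))) 0 :=
    hψ.comp_of_eq (contDiff_geodesicRay (N := 0)).continuous.continuousAt (geodesicRay_zero ρ e)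
  exact hcomp.continuousWithinAt.congr
    (fun t ht => congrArg ψ (hypDist_zero_geodesicRay hρ he ht).symm)
    (congrArg ψ (hypDist_zero_geodesicRay hρ he le_rfl).symm)

end GeodesicRay

section RadialEigenfunctions

variable {k : ℕ} {ρ r : ℝ} {μ : ℂ} {φ ψ : ℝ → ℂ} {Ω Ω' : Set (EuclideanSpace ℝ (Fin (k + 1)))}

theorem IsRadialEigenfunctionOn.mono (hψ : IsRadialEigenfunctionOn k ρ μ Ω ψ) (h : Ω' ⊆ Ω) :
    IsRadialEigenfunctionOn k ρ μ Ω' ψ :=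
  ⟨hψ.1.mono h, fun m hm => hψ.2 m (h hm)⟩

theorem IsRadialEigenfunctionOn.continuousWithinAt (hρ : 0 < ρ)
    (hψ : IsRadialEigenfunctionOn k ρ μ (ball 0 ρ) ψ) : ContinuousWithinAt ψ (Ici 0) 0 :=
  continuousWithinAt_of_comp_hypDist (e := EuclideanSpace.single 0 1) hρ (by simp)
    (hψ.1.continuousOn.continuousAt (ball_mem_nhds 0 hρ))

theorem IsRadialEigenfunctionOn.contDiffAt
    (hψ : IsRadialEigenfunctionOn k ρ μ (ball 0 ρ \ {0}) ψ) (hρ : 0 < ρ) (hr : 0 < r) :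
    ContDiffAt ℝ 2 ψ r := by
  have he : ‖(EuclideanSpace.single 0 1 : EuclideanSpace ℝ (Fin (k + 1)))‖ = 1 := by simp
  exact contDiffAt_of_comp_hypDist hρ he hr (hψ.1.contDiffAt
    ((isOpen_ball.sdiff isClosed_singleton).mem_nhds
      ⟨geodesicRay_mem_ball hρ he hr.le, geodesicRay_ne_zero hρ he hr⟩))

theorem IsRadialEigenfunctionOn.deriv_deriv_add
    (hψ : IsRadialEigenfunctionOn k ρ μ (ball 0 ρ \ {0}) ψ) (hρ : 0 < ρ) (hr : 0 < r) :
    deriv (deriv ψ) r + (k / ρ * (Real.cosh (r / ρ) / Real.sinh (r / ρ))) • deriv ψ r + μ * ψ r =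
      0 := by
  have he : ‖(EuclideanSpace.single 0 1 : EuclideanSpace ℝ (Fin (k + 1)))‖ = 1 := by simp
  set m := geodesicRay ρ (EuclideanSpace.single 0 1 : EuclideanSpace ℝ (Fin (k + 1))) r
  have hm : m ∈ ball 0 ρ := geodesicRay_mem_ball hρ he hr.le
  have hm0 : m ≠ 0 := geodesicRay_ne_zero hρ he hr
  have hmr : hypDist ρ 0 m = r := hypDist_zero_geodesicRay hρ he hr.le
  have hmr' : radialDist ρ ‖m‖ = r := by rw [← hypDist_zero_left hm, hmr]
  have hcongr : (fun x : EuclideanSpace ℝ (Fin (k + 1)) => ψ (hypDist ρ 0 x)) =ᶠ[𝓝 m]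
      fun x => ψ (radialDist ρ ‖x‖) := by
    filter_upwards [isOpen_ball.mem_nhds hm] with x hx
    rw [hypDist_zero_left hx]
  have hψr : ContDiffAt ℝ 2 ψ (radialDist ρ ‖m‖) := by
    rw [hmr']
    exact hψ.contDiffAt hρ hr
  have heq := hψ.2 m ⟨hm, hm0⟩
  rwa [hypLaplacian_eq_ballLaplacian hm (hψ.1.contDiffAt
    ((isOpen_ball.sdiff isClosed_singleton).mem_nhds ⟨hm, hm0⟩)), ballLaplacian_congr hcongr,
    ballLaplacian_comp_radialDist_norm hm hm0 hψr, hmr, hmr', finrank_euclideanSpace_fin,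
    Nat.cast_succ, add_sub_cancel_right] at heq

theorem IsRadialEigenfunctionOn.isSturmLiouvilleSolutionOn (hρ : 0 < ρ)
    (hψ : IsRadialEigenfunctionOn k ρ μ (ball 0 ρ \ {0}) ψ) :
    IsSturmLiouvilleSolutionOn (fun t => Real.sinh (t / ρ) ^ k)
      (fun t => μ * (Real.sinh (t / ρ) ^ k : ℝ)) ψ (Ioi 0) := by
  intro t ht
  have hsinh : Real.sinh (t / ρ) ≠ 0 := (Real.sinh_pos_iff.2 (div_pos ht hρ)).ne'
  have hderiv : HasDerivAt (deriv ψ) (deriv (deriv ψ) t) t :=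
    (((hψ.contDiffAt hρ ht).derivWithin (m := 1) (by norm_num)).differentiableAt
      one_ne_zero).hasDerivAt
  have hweight : HasDerivAt (fun r => Real.sinh (r / ρ) ^ k)
      (Real.sinh (t / ρ) ^ k * (k / ρ * (Real.cosh (t / ρ) / Real.sinh (t / ρ)))) t := by
    refine ((((hasDerivAt_id t).div_const ρ).sinh).pow k).congr_deriv ?_
    rcases k with _ | k
    · simp
    · simp only [id, Nat.add_sub_cancel]
      field_simp
      exact (pow_succ _ _).symm
  refine ⟨(hψ.contDiffAt hρ ht).differentiableAt two_ne_zero,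
    (hweight.smul hderiv).congr_deriv ?_⟩
  rw [mul_smul, ← smul_add, eq_neg_of_add_eq_zero_left (hψ.deriv_deriv_add hρ ht)]
  simp only [Complex.real_smul]
  ring

theorem exists_forall_sinh_div_pow_le (hk : 1 ≤ k) (ρ : ℝ) :
    ∃ δ > 0, ∃ K, ∀ t ∈ Ioo 0 δ, Real.sinh (t / ρ) ^ k ≤ K * t := by
  have hdiff : DifferentiableAt ℝ (fun t => Real.sinh (t / ρ) ^ k) 0 := by fun_prop
  obtain ⟨K, hK⟩ := hdiff.isBigO_sub.bound
  obtain ⟨δ, hδ, hsub⟩ := mem_nhdsGT_iff_exists_Ioo_subset.1 (nhdsWithin_le_nhds hK)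
  refine ⟨δ, hδ, K, fun t ht => ?_⟩
  have hle : ‖Real.sinh (t / ρ) ^ k - Real.sinh (0 / ρ) ^ k‖ ≤ K * ‖t - 0‖ := hsub ht
  rw [zero_div, Real.sinh_zero, zero_pow (Nat.one_le_iff_ne_zero.1 hk), sub_zero, sub_zero,
    Real.norm_of_nonneg ht.1.le] at hle
  exact (Real.le_norm_self _).trans hle

theorem IsRadialEigenfunctionOn.eqOn_Ici (hk : 1 ≤ k) (hρ : 0 < ρ)
    (hψ : IsRadialEigenfunctionOn k ρ μ (ball 0 ρ \ {0}) ψ)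
    (hφ : IsRadialEigenfunctionOn k ρ μ (ball 0 ρ \ {0}) φ)
    (hψ0 : ContinuousWithinAt ψ (Ici 0) 0) (hφ0 : ContinuousWithinAt φ (Ici 0) 0)
    (h : ψ 0 = φ 0) (hne : φ 0 ≠ 0) : EqOn ψ φ (Ici 0) := by
  intro r hr
  rcases (mem_Ici.1 hr).eq_or_lt with rfl | hr
  · exact h
  obtain ⟨δ, hδ, K, hK⟩ := exists_forall_sinh_div_pow_le hk ρ
  have hψlim : Tendsto ψ (𝓝[>] 0) (𝓝 (φ 0)) := h ▸ hψ0.mono Ioi_subset_Ici_self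
  have hweight : Continuous fun t => Real.sinh (t / ρ) ^ k := by fun_prop
  exact ((hψ.isSturmLiouvilleSolutionOn hρ).mono Ioo_subset_Ioi_self).eqOn_Ioo hδ
    (le_max_left δ (r + 1)) hweight.continuousOn
    (fun t ht => pow_pos (Real.sinh_pos_iff.2 (div_pos ht.1 hρ)) k) hK (by fun_prop)
    ((hφ.isSturmLiouvilleSolutionOn hρ).mono Ioo_subset_Ioi_self) hne hψlim
    (hφ0.mono Ioi_subset_Ici_self) ⟨hr, (lt_add_one r).trans_le (le_max_right _ _)⟩

end RadialEigenfunctions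

section UnitSphere

variable {E G : Type*} [NormedAddCommGroup E] [NormedSpace ℝ E] [MeasurableSpace E] [BorelSpace E]
  {μ : Measure E}

/-- The action of a linear isometry on the unit sphere. -/
def unitSphereHomeomorph (R : E ≃ₗᵢ[ℝ] E) : sphere (0 : E) 1 ≃ₜ sphere (0 : E) 1 :=
  R.toHomeomorph.subtype fun x => by simp

theorem measurePreserving_unitSphereHomeomorph (R : E ≃ₗᵢ[ℝ] E) (hR : MeasurePreserving R μ μ) :
    MeasurePreserving (unitSphereHomeomorph R) μ.toSphere μ.toSphere := by
  refine ⟨(unitSphereHomeomorph R).measurable, Measure.ext fun s hs => ?_⟩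
  have hcone : Ioo (0 : ℝ) 1 • (Subtype.val '' (unitSphereHomeomorph R ⁻¹' s)) =
      R ⁻¹' (Ioo (0 : ℝ) 1 • (Subtype.val '' s)) := by
    ext x
    simp only [Set.mem_smul, mem_image, mem_preimage]
    constructor
    · rintro ⟨t, ht, _, ⟨θ, hθ, rfl⟩, rfl⟩
      exact ⟨t, ht, _, ⟨_, hθ, rfl⟩, (map_smul R t _).symm⟩
    · rintro ⟨t, ht, _, ⟨θ, hθ, rfl⟩, hx⟩
      refine ⟨t, ht, _, ⟨(unitSphereHomeomorph R).symm θ, by simpa using hθ, rfl⟩, R.injective ?_⟩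
      rw [map_smul, ← hx]
      exact congrArg (t • ·) (R.apply_symm_apply θ)
  rw [Measure.map_apply (unitSphereHomeomorph R).measurable hs, Measure.toSphere_apply' _ hs,
    Measure.toSphere_apply' _ ((unitSphereHomeomorph R).measurable hs), hcone,
    hR.measure_preimage_emb R.toHomeomorph.measurableEmbedding]

theorem average_toSphere_comp [NormedAddCommGroup G] [NormedSpace ℝ G] (R : E ≃ₗᵢ[ℝ] E)
    (hR : MeasurePreserving R μ μ) (f : E → G) :
    ⨍ θ : sphere (0 : E) 1, f (R θ) ∂μ.toSphere = ⨍ θ : sphere (0 : E) 1, f θ ∂μ.toSphere := by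
  rw [average_eq, average_eq]
  exact congrArg _ ((measurePreserving_unitSphereHomeomorph R hR).integral_comp
    (unitSphereHomeomorph R).measurableEmbedding fun θ => f θ)

end UnitSphere

section SphericalMean

variable {k : ℕ} {η : ℝ}

instance : IsFiniteMeasure (sphereMeasure k η) :=
  Measure.smul_finite _ ENNReal.ofReal_ne_top

theorem sphereMeasure_restrict_sphere (hη : 0 ≤ η) :
    (sphereMeasure k η).restrict (sphere 0 η) = sphereMeasure k η := by
  refine Measure.restrict_eq_self_of_ae_mem (Measure.ae_smul_measure ?_ _)
  refine (ae_map_iff (p := (· ∈ sphere 0 η)) (by fun_prop) isClosed_sphere.measurableSet).2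
    (.of_forall fun θ => by simp [norm_smul, abs_of_nonneg hη])

theorem sphericalMean_eq_average (f : EuclideanSpace ℝ (Fin (k + 1)) → ℂ) (hη : 0 ≤ η) :
    sphericalMean k f η = ⨍ θ : sphere (0 : EuclideanSpace ℝ (Fin (k + 1))) 1,
      f (η • (θ : EuclideanSpace ℝ (Fin (k + 1))))
        ∂(volume : Measure (EuclideanSpace ℝ (Fin (k + 1)))).toSphere := by
  rcases hη.eq_or_lt with rfl | hη
  · have : NeZero (volume : Measure (EuclideanSpace ℝ (Fin (k + 1)))).toSphere :=
      ⟨Measure.toSphere_ne_zero _⟩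
    simp only [sphericalMean, if_true, zero_smul, average_const]
  have hemb : MeasurableEmbedding fun θ : sphere (0 : EuclideanSpace ℝ (Fin (k + 1))) 1 =>
      η • (θ : EuclideanSpace ℝ (Fin (k + 1))) :=
    Continuous.measurableEmbedding (by fun_prop) fun a b h =>
      Subtype.ext (smul_right_injective _ hη.ne' h)
  rw [sphericalMean, if_neg hη.ne', sphereMeasure, integral_smul_measure, hemb.integral_map,
    measureReal_ennreal_smul_apply, map_measureReal_apply hemb.measurable .univ, preimage_univ,
    smul_smul, mul_inv, mul_right_comm, inv_mul_cancel₀, one_mul, average_eq]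
  rw [ENNReal.toReal_ofReal (by positivity)]
  positivity

theorem sphericalMean_comp
    (R : EuclideanSpace ℝ (Fin (k + 1)) ≃ₗᵢ[ℝ] EuclideanSpace ℝ (Fin (k + 1)))
    (f : EuclideanSpace ℝ (Fin (k + 1)) → ℂ) (hη : 0 ≤ η) :
    sphericalMean k (fun v => f (R v)) η = sphericalMean k f η := by
  simp only [sphericalMean_eq_average _ hη, map_smul]
  exact average_toSphere_comp R R.measurePreserving fun θ => f (η • θ)

theorem exists_norm_eq_one_norm_smul_eq {E : Type*} [NormedAddCommGroup E] [NormedSpace ℝ E]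
    [Nontrivial E] (x : E) : ∃ e : E, ‖e‖ = 1 ∧ ‖x‖ • e = x := by
  rcases eq_or_ne x 0 with rfl | hx
  · obtain ⟨e, he⟩ := exists_norm_eq E zero_le_one
    exact ⟨e, he, by rw [norm_zero, zero_smul]⟩
  · exact ⟨NormedSpace.normalize x, NormedSpace.norm_normalize hx,
      NormedSpace.norm_smul_normalize x⟩

theorem exists_linearIsometryEquiv_swap {E : Type*} [NormedAddCommGroup E] [InnerProductSpace ℝ E]
    {a b : E} (h : ‖a‖ = ‖b‖) : ∃ R : E ≃ₗᵢ[ℝ] E, R a = b ∧ R b = a := by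
  have hab := Submodule.reflection_sub h
  exact ⟨_, hab, (congrArg (ℝ ∙ (a - b))ᗮ.reflection hab.symm).trans
    (Submodule.reflection_reflection _ a)⟩

theorem sphericalMean_norm_comm
    {f : EuclideanSpace ℝ (Fin (k + 1)) → EuclideanSpace ℝ (Fin (k + 1)) → ℂ}
    (hf : ∀ (R : EuclideanSpace ℝ (Fin (k + 1)) ≃ₗᵢ[ℝ] EuclideanSpace ℝ (Fin (k + 1))) u m,
      f (R u) (R m) = f u m) (u m : EuclideanSpace ℝ (Fin (k + 1))) :
    sphericalMean k (f u) ‖m‖ = sphericalMean k (fun v => f v m) ‖u‖ := by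
  obtain ⟨a, ha, hau⟩ := exists_norm_eq_one_norm_smul_eq u
  obtain ⟨b, hb, hbm⟩ := exists_norm_eq_one_norm_smul_eq m
  obtain ⟨R, -, hba⟩ := exists_linearIsometryEquiv_swap (ha.trans hb.symm)
  rw [← sphericalMean_comp R _ (norm_nonneg m), sphericalMean_eq_average _ (norm_nonneg m),
    sphericalMean_eq_average _ (norm_nonneg u)]
  refine congrArg _ (funext fun θ => ?_)
  obtain ⟨T, hθ, hb'⟩ := exists_linearIsometryEquiv_swap
    ((norm_eq_of_mem_sphere θ).trans hb.symm)
  calc f u (R (‖m‖ • θ)) = f (R (‖u‖ • b)) (R (‖m‖ • θ)) := by rw [map_smul R _ b, hba, hau]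
    _ = f (T (‖u‖ • θ)) (T (‖m‖ • b)) := by rw [hf, map_smul, map_smul, hθ, hb']
    _ = f (‖u‖ • θ) m := by rw [hf, hbm]

end SphericalMean

section SphericalMeanPoissonKernel

variable {k : ℕ} {u m : EuclideanSpace ℝ (Fin (k + 1))} {α : ℂ}

theorem omega_map {n : ℕ} (R : EuclideanSpace ℝ (Fin n) ≃ₗᵢ[ℝ] EuclideanSpace ℝ (Fin n))
    (v x : EuclideanSpace ℝ (Fin n)) : omega (R v) (R x) = omega v x := by
  rw [omega, omega, ← map_sub, R.norm_map, R.norm_map, R.norm_map]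

theorem V_zero (hu : u ≠ 0) (α : ℂ) : V k u α 0 = 1 := by
  simp [V, sphericalMean, omega, hu]

/-- Averaging over the boundary point instead of the interior one expresses `V` through the
eigenfunctions `ω(v, ·) ^ α` at the fixed point `m`. -/
theorem V_norm_eq_smul_setIntegral (hu : u ≠ 0) (α : ℂ) (m : EuclideanSpace ℝ (Fin (k + 1))) :
    V k u α ‖m‖ = ((sphereMeasure k ‖u‖).real univ)⁻¹ •
      ∫ v in sphere 0 ‖u‖, (omega v m : ℂ) ^ α ∂sphereMeasure k ‖u‖ := by
  rw [V, sphericalMean_norm_comm (f := fun v x => (omega v x : ℂ) ^ α)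
    (fun R v x => by rw [omega_map]), sphericalMean, if_neg (norm_ne_zero_iff.2 hu),
    sphereMeasure_restrict_sphere (norm_nonneg u)]

theorem contDiffAt_uncurry_omega_cpow {N : WithTop ℕ∞} {n : ℕ} {v x : EuclideanSpace ℝ (Fin n)}
    (h : ‖x‖ < ‖v‖) (α : ℂ) :
    ContDiffAt ℝ N (Function.uncurry fun y v : EuclideanSpace ℝ (Fin n) => (omega v y : ℂ) ^ α)
      (x, v) := by
  have hnhds := isOpen_setOf_norm_snd_lt_norm_fst.mem_nhds (show (v, x) ∈ _ from h)
  have hlog := ((contDiffOn_omega (N := N)).contDiffAt hnhds).log (omega_pos h).ne'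
  have hswap : ContDiffAt ℝ N (fun p : EuclideanSpace ℝ (Fin n) × EuclideanSpace ℝ (Fin n) =>
      Real.log (omega p.2 p.1)) (x, v) :=
    hlog.comp (x, v) (f := Prod.swap) (contDiffAt_snd.prodMk contDiffAt_fst)
  refine ((contDiff_cexp_ofReal_mul α).contDiffAt.comp (x, v) hswap).congr_of_eventuallyEq ?_
  filter_upwards [(isOpen_setOf_norm_snd_lt_norm_fst.preimage continuous_swap).mem_nhds
    (show (x, v) ∈ _ from h)] with p hp
  exact omega_cpow_eq_exp hp α

theorem contDiffAt_uncurry_omega_cpow_of_mem_sphere (hm : m ∈ ball 0 ‖u‖) (α : ℂ) {n : ℕ} :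
    ∀ v ∈ sphere 0 ‖u‖, ContDiffAt ℝ n (Function.uncurry
      fun y v : EuclideanSpace ℝ (Fin (k + 1)) => (omega v y : ℂ) ^ α) (m, v) :=
  fun v hv => contDiffAt_uncurry_omega_cpow
    (by rwa [mem_sphere_zero_iff_norm.1 hv, ← mem_ball_zero_iff]) α

theorem contDiffAt_V_norm {n : ℕ} (hm : m ∈ ball 0 ‖u‖) (α : ℂ) :
    ContDiffAt ℝ n (fun x : EuclideanSpace ℝ (Fin (k + 1)) => V k u α ‖x‖) m := by
  have hu : u ≠ 0 := norm_pos_iff.1 (pos_of_mem_ball hm)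
  simp only [V_norm_eq_smul_setIntegral hu]
  exact (contDiffAt_setIntegral (isCompact_sphere 0 ‖u‖)
    (contDiffAt_uncurry_omega_cpow_of_mem_sphere hm α)).const_smul _

theorem ballLaplacian_V_norm (hm : m ∈ ball 0 ‖u‖) (α : ℂ) :
    ballLaplacian ‖u‖ (fun x : EuclideanSpace ℝ (Fin (k + 1)) => V k u α ‖x‖) m =
      -((α * k - α ^ 2) / ‖u‖ ^ 2) * V k u α ‖m‖ := by
  have hu : u ≠ 0 := norm_pos_iff.1 (pos_of_mem_ball hm)
  have hkernel : ∀ v ∈ sphere (0 : EuclideanSpace ℝ (Fin (k + 1))) ‖u‖,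
      ballLaplacian ‖u‖ (fun x => (omega v x : ℂ) ^ α) m =
        -((α * k - α ^ 2) / ‖u‖ ^ 2) * (omega v m : ℂ) ^ α := fun v hv => by
    have hv' : ‖v‖ = ‖u‖ := mem_sphere_zero_iff_norm.1 hv
    rw [← hv', ballLaplacian_omega_cpow α (by rwa [hv']), Nat.cast_succ, add_sub_cancel_right]
  simp only [V_norm_eq_smul_setIntegral hu]
  rw [ballLaplacian_const_smul _ (contDiffAt_setIntegral (isCompact_sphere 0 ‖u‖)
      (contDiffAt_uncurry_omega_cpow_of_mem_sphere hm α)),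
    ballLaplacian_setIntegral _ (isCompact_sphere 0 ‖u‖)
      (contDiffAt_uncurry_omega_cpow_of_mem_sphere hm α),
    setIntegral_congr_fun isClosed_sphere.measurableSet hkernel, integral_const_mul,
    mul_smul_comm]

theorem isRadialEigenfunctionOn_V (u : EuclideanSpace ℝ (Fin (k + 1))) (α : ℂ) :
    IsRadialEigenfunctionOn k ‖u‖ ((α * k - α ^ 2) / ‖u‖ ^ 2) (ball 0 ‖u‖)
      fun r => V k u α (‖u‖ * Real.tanh (r / (2 * ‖u‖))) := by
  have hradial (m : EuclideanSpace ℝ (Fin (k + 1))) (hm : m ∈ ball 0 ‖u‖) :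
      V k u α (‖u‖ * Real.tanh (hypDist ‖u‖ 0 m / (2 * ‖u‖))) = V k u α ‖m‖ := by
    rw [← norm_eq_mul_tanh_hypDist hm]
  have hsmooth (m : EuclideanSpace ℝ (Fin (k + 1))) (hm : m ∈ ball 0 ‖u‖) :
      ContDiffAt ℝ 2 _ m := contDiffAt_V_norm (n := 2) hm α
  have hcongr (m : EuclideanSpace ℝ (Fin (k + 1))) (hm : m ∈ ball 0 ‖u‖) :=
    eventuallyEq_of_mem (isOpen_ball.mem_nhds hm) hradial
  refine ⟨fun m hm => ((hsmooth m hm).congr_of_eventuallyEq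
    (hcongr m hm)).contDiffWithinAt, fun m hm => ?_⟩
  rw [hypLaplacian_eq_ballLaplacian hm ((hsmooth m hm).congr_of_eventuallyEq (hcongr m hm)),
    ballLaplacian_congr (hcongr m hm), ballLaplacian_V_norm hm]
  simp only [hradial m hm]
  ring

end SphericalMeanPoissonKernel

end HypBall

theorem mainTheorem3 (k : ℕ) (hk : 1 ≤ k) (ρ : ℝ) (hρ : 0 < ρ)
    (u : EuclideanSpace ℝ (Fin (k + 1))) (hu : ‖u‖ = ρ) (α μ : ℂ)
    (hμ : μ = (α * (k : ℂ) - α ^ 2) / (ρ : ℂ) ^ 2)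
    (φ : ℝ → ℂ) (hφ : φ = fun r => HypBall.V k u α (ρ * Real.tanh (r / (2 * ρ)))) :
    -- the Euclidean radius in terms of the hyperbolic distance, so that `φ(r) = V_α(η(r))`
    (∀ m ∈ Metric.ball (0 : EuclideanSpace ℝ (Fin (k + 1))) ρ,
        ‖m‖ = ρ * Real.tanh (HypBall.hypDist ρ 0 m / (2 * ρ)) ∧
        φ (HypBall.hypDist ρ 0 m) = HypBall.V k u α ‖m‖) ∧
    -- `φ` is a radial eigenfunction on the whole ball, with value `1` at the origin
    HypBall.IsRadialEigenfunctionOn k ρ μ (Metric.ball 0 ρ) φ ∧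
    φ 0 = 1 ∧
    -- uniqueness, even if the equation is only required away from the origin
    (∀ ψ : ℝ → ℂ,
        HypBall.IsRadialEigenfunctionOn k ρ μ (Metric.ball 0 ρ \ {0}) ψ →
        ContinuousWithinAt ψ (Set.Ici 0) 0 →
        ψ 0 = 1 →
        ∀ r : ℝ, 0 ≤ r → ψ r = φ r) ∧
    (∀ ψ : ℝ → ℂ,
        HypBall.IsRadialEigenfunctionOn k ρ μ (Metric.ball 0 ρ) ψ →
        ψ 0 = 1 →
        ∀ r : ℝ, 0 ≤ r → ψ r = φ r) := by
  obtain rfl : ‖u‖ = ρ := hu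
  have hu : u ≠ 0 := norm_pos_iff.1 hρ
  subst hμ hφ
  have hφ0 : HypBall.V k u α (‖u‖ * Real.tanh (0 / (2 * ‖u‖))) = 1 := by
    rw [zero_div, Real.tanh_zero, mul_zero, HypBall.V_zero hu]
  have hφ := HypBall.isRadialEigenfunctionOn_V u α
  have hunique (ψ : ℝ → ℂ)
      (hψ : HypBall.IsRadialEigenfunctionOn k ‖u‖ _ (ball 0 ‖u‖ \ {0}) ψ)
      (hψc : ContinuousWithinAt ψ (Ici 0) 0) (hψ0 : ψ 0 = 1) (r : ℝ) (hr : 0 ≤ r) :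
      ψ r = HypBall.V k u α (‖u‖ * Real.tanh (r / (2 * ‖u‖))) :=
    hψ.eqOn_Ici hk hρ (hφ.mono sdiff_subset) hψc (hφ.continuousWithinAt hρ)
      (hψ0.trans hφ0.symm) (hφ0.trans_ne one_ne_zero) hr
  refine ⟨fun m hm => ?_, hφ, hφ0, hunique, fun ψ hψ =>
    hunique ψ (hψ.mono sdiff_subset) (hψ.continuousWithinAt hρ)⟩
  have hm' := HypBall.norm_eq_mul_tanh_hypDist hm
  exact ⟨hm', by simp only [← hm']⟩
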